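/- Let $K_n$ be the complete directed graph on $n\ge 2$ vertices (with all $n(n-1)$ edges $a\to b$, $a\neq b$). A path is a sequence of distinct vertices; a single vertex is an empty path. Given real edge weights, the length of a path is the sum of the weights of its edges, and a path is a shortest path if no path with the same first and the same last vertex is shorter. A path with at least one edge is a locally shortest path (LSP) if the path obtained by deleting its first edge and the path obtained by deleting its last edge are both shortest paths. In a random edge update of the randomly weighted graph, the initial edge weights are independent and uniform on $[0,1]$; an edge $e$ is chosen uniformly at random among the $n(n-1)$ edges; and $e$ is given a new weight, uniform on $[0,1]$, while all other weights are kept. The initial weights, $e$ and the new weight are independent. Let $\mathcal{LSP}_0$ and $\mathcal{LSP}_1$ be the sets of locally shortest paths before and after the update, and let $\mathcal{LSP}_i(e)$ be the set of those paths in $\mathcal{LSP}_i$ that pass through $e$. The sets of destroyed and of created (or recreated) locally shortest paths are $$\mathcal{LSP}^-=\mathcal{LSP}_0(e)\cup(\mathcal{LSP}_0\setminus\mathcal{LSP}_1),\qquad \mathcal{LSP}^+=\mathcal{LSP}_1(e)\cup(\mathcal{LSP}_1\setminus\mathcal{LSP}_0).$$ Theorem. For every $n\ge 2$ the random variables $|\mathcal{LSP}^-|$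 and $|\mathcal{LSP}^+|$ are integrable and $\mathbb{E}[|\mathcal{LSP}^-|]=\mathbb{E}[|\mathcal{LSP}^+|]$. Moreover $\mathbb{E}[|\mathcal{LSP}^-|]=O(\log^2 n)$ and $\mathbb{E}[|\mathcal{LSP}^+|]=O(\log^2 n)$ as $n\to\infty$. -/

import Mathlib

open MeasureTheory Filter Asymptotics

namespace RandomAPSP

/-- The `n * (n - 1)` edges of the complete directed graph on the vertex set `Fin n`. -/
abbrev Edge (n : ℕ) : Type := {p : Fin n × Fin n // p.1 ≠ p.2}

/-- The weight of the edge from `a` to `b`. The value `0` for `a = b` is never used on a path. -/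
noncomputable def edgeCost {n : ℕ} (w : Edge n → ℝ) (a b : Fin n) : ℝ :=
  if h : a ≠ b then w ⟨(a, b), h⟩ else 0

/-- A (directed, simple) path in the complete directed graph, given by its sequence of vertices.
Any two consecutive vertices are distinct, so they span an edge. The one-term sequence `[v]` is the
empty path (the path without edges) at `v`. -/
def IsPath {n : ℕ} (p : List (Fin n)) : Prop :=
  p ≠ [] ∧ p.Nodup

/-- The length of a path: the sum of the weights of its edges. -/
noncomputable def pathCost {n : ℕ} (w : Edge n → ℝ) : List (Fin n) → ℝ
  | [] => 0
  | [_] => 0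
  | a :: b :: p => edgeCost w a b + pathCost w (b :: p)

/-- The path `p` uses the edge `e`: its endpoints are consecutive vertices of `p`, in this order. -/
def PassesThrough {n : ℕ} (p : List (Fin n)) (e : Edge n) : Prop :=
  [e.1.1, e.1.2] <:+: p

/-- `p` is a shortest path: no path with the same first and the same last vertex is shorter. -/
def IsShortestPath {n : ℕ} (w : Edge n → ℝ) (p : List (Fin n)) : Prop :=
  IsPath p ∧ ∀ q : List (Fin n), IsPath q → q.head? = p.head? → q.getLast? = p.getLast? →
    pathCost w p ≤ pathCost w q

/-- `p` is a locally shortest path: the path obtained by deleting its first edge and the path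
obtained by deleting its last edge are both shortest paths. (For `p = [v]` the condition fails as
there is no edge to delete. Such paths use no edge and are affected by no update.) -/
def IsLocallyShortestPath {n : ℕ} (w : Edge n → ℝ) (p : List (Fin n)) : Prop :=
  IsPath p ∧ IsShortestPath w p.tail ∧ IsShortestPath w p.dropLast

/-- The set of locally shortest paths for the edge weights `w`. -/
def LSP {n : ℕ} (w : Edge n → ℝ) : Set (List (Fin n)) :=
  {p | IsLocallyShortestPath w p}

/-- The set of locally shortest paths that pass through the edge `e`. -/
def LSPThrough {n : ℕ} (w : Edge n → ℝ) (e : Edge n) : Set (List (Fin n)) :=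
  {p | p ∈ LSP w ∧ PassesThrough p e}

/-- An edge update: the edge `edge` gets the new weight `newWeight`, all other edges keep the weight
that `weights` gives them. The three components are the edge, the weights before, and the new
weight. -/
abbrev EdgeUpdate (n : ℕ) : Type := Edge n × (Edge n → ℝ) × ℝ

/-- The updated edge. -/
def EdgeUpdate.edge {n : ℕ} (u : EdgeUpdate n) : Edge n := u.1

/-- The edge weights before the update. -/
def EdgeUpdate.before {n : ℕ} (u : EdgeUpdate n) : Edge n → ℝ := u.2.1

/-- The edge weights after the update. -/
def EdgeUpdate.after {n : ℕ} (u : EdgeUpdate n) : Edge n → ℝ :=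
  Function.update u.2.1 u.1 u.2.2

/-- The set of locally shortest paths destroyed by the update. -/
def destroyedLSP {n : ℕ} (u : EdgeUpdate n) : Set (List (Fin n)) :=
  LSPThrough (EdgeUpdate.before u) (EdgeUpdate.edge u) ∪
    (LSP (EdgeUpdate.before u) \ LSP (EdgeUpdate.after u))

/-- The set of locally shortest paths created (or recreated) by the update. -/
def createdLSP {n : ℕ} (u : EdgeUpdate n) : Set (List (Fin n)) :=
  LSPThrough (EdgeUpdate.after u) (EdgeUpdate.edge u) ∪
    (LSP (EdgeUpdate.after u) \ LSP (EdgeUpdate.before u))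

/-- The uniform distribution on `[0, 1]`. -/
noncomputable def uniform01 : Measure ℝ := volume.restrict (Set.Icc 0 1)

/-- The law of a random edge update of the randomly weighted complete directed graph: the updated
edge is uniform among all edges, the weights before the update are independent and uniform on
`[0, 1]`, the new weight is uniform on `[0, 1]`, and these three are independent. -/
noncomputable def randomEdgeUpdate (n : ℕ) : Measure (EdgeUpdate n) :=
  (ProbabilityTheory.uniformOn (Set.univ : Set (Edge n))).prod
    ((Measure.pi fun _ : Edge n => uniform01).prod uniform01)

/-- The expected number of locally shortest paths destroyed by a random edge update. -/
noncomputable def expectedDestroyedLSP (n : ℕ) : ℝ :=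
  ∫ u, ((destroyedLSP u).ncard : ℝ) ∂(randomEdgeUpdate n)

/-- The expected number of locally shortest paths created by a random edge update. -/
noncomputable def expectedCreatedLSP (n : ℕ) : ℝ :=
  ∫ u, ((createdLSP u).ncard : ℝ) ∂(randomEdgeUpdate n)

end RandomAPSP

/-!
An update and the reversed update, which gives the edge its old weight back, have the same law, and
reversal turns destroyed paths into created ones. So both numbers have the same expectation, and it
suffices to bound the number of destroyed paths. (`measurePreserving_reverse`,
`destroyedLSP_reverse`)

Put `r = 256 log n / n`. With probability `1 - O(n⁻³)` the weights are typical
(`weightLaw_real_not_isTypical_le`): all distances are at most `r`, every vertex has `O(log n)`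
outgoing and incoming edges of weight at most `r`, and paths of cost at most `r` have `O(log n)`
edges. The last two properties follow from exponential Markov inequalities and union bounds. For the
distances, the graph is explored from a vertex in rounds: the next set consists of the vertices not
yet explored that are reached from the current set by an edge of weight at most some threshold. As
the edges out of the unexplored vertices have not been inspected, the rounds are independent
(`weightLaw_real_unreached_add_le`). A first round with threshold of order `log n / n` reaches
`5 log n` vertices, then `O(log n)` rounds with threshold `24 / n` double the set until it contains a
constant fraction of the vertices, and a last round with threshold of order `log n / n` reaches
everything else.

Almost surely different paths with the same ends have different costs, so there are at most `n²`
shortest paths. For typical weights, the first edge of a locally shortest path with at least two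
edges has weight at most `r`, so there are `O(n² log n)` locally shortest paths, each with
`O(log n)` edges. Hence `O(log² n)` of them pass through a random edge, and similarly `O(log n)`
shortest paths do. A destroyed path that avoids the updated edge `e` arises by adding one edge of
weight at most `r` at an end of a shortest path that has been replaced by a new shortest path through
`e` (`IsTypical.ncard_destroyed_le`). The new weights have the same law as the old ones and are
independent of `e`, so in expectation `O(log n)` paths are replaced, each of which accounts for
`O(log n)` destroyed paths. Weights that are not typical contribute at most `n³` destroyed paths,
which their small probability outweighs.
-/

namespace RandomAPSP

/-! ### Paths and their edges -/

section Paths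

variable {n : ℕ}

theorem edgeCost_of_ne (w : Edge n → ℝ) {a b : Fin n} (h : a ≠ b) :
    edgeCost w a b = w ⟨(a, b), h⟩ := dif_pos h

theorem edgeCost_nonneg {w : Edge n → ℝ} (hw : ∀ e, 0 ≤ w e) (a b : Fin n) :
    0 ≤ edgeCost w a b := by
  unfold edgeCost
  split_ifs
  · exact hw _
  · exact le_rfl

theorem pathCost_nonneg {w : Edge n → ℝ} (hw : ∀ e, 0 ≤ w e) :
    ∀ p : List (Fin n), 0 ≤ pathCost w p
  | [] => le_rfl
  | [_] => le_rfl
  | a :: b :: p => add_nonneg (edgeCost_nonneg hw a b) (pathCost_nonneg hw (b :: p))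

theorem pathCost_take_le {w : Edge n → ℝ} (hw : ∀ e, 0 ≤ w e) :
    ∀ (p : List (Fin n)) (k : ℕ), pathCost w (p.take k) ≤ pathCost w p
  | [], k => by simp
  | [a], k => by cases k <;> simp [pathCost]
  | a :: b :: p, 0 => pathCost_nonneg hw _
  | a :: b :: p, 1 => by simpa [pathCost] using pathCost_nonneg hw (a :: b :: p)
  | a :: b :: p, k + 2 => by
      have := pathCost_take_le hw (b :: p) (k + 1)
      simp only [List.take_succ_cons, pathCost] at this ⊢
      linarith

theorem edgeCost_le_pathCost_append {w : Edge n → ℝ} (hw : ∀ e, 0 ≤ w e) (a b : Fin n) :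
    ∀ p : List (Fin n), edgeCost w a b ≤ pathCost w (p ++ [a, b])
  | [] => by simp [pathCost]
  | [c] => by simpa [pathCost] using edgeCost_nonneg hw c a
  | c :: d :: p => by
      have := edgeCost_le_pathCost_append hw a b (d :: p)
      have := edgeCost_nonneg hw c d
      simp only [List.cons_append, pathCost] at *
      linarith

/-- The cost of a path depends only on the weights of edges from a vertex of the path to a vertex
of the path other than its first one. -/
theorem pathCost_congr {w w' : Edge n → ℝ} : ∀ {p : List (Fin n)},
    (∀ e : Edge n, e.1.1 ∈ p → e.1.2 ∈ p.tail → w e = w' e) → pathCost w p = pathCost w' p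
  | [], _ => rfl
  | [_], _ => rfl
  | a :: b :: p, h => by
      have h1 : edgeCost w a b = edgeCost w' a b := by
        unfold edgeCost
        split_ifs with hab
        · exact h _ (by simp) (by simp)
        · rfl
      have h2 : pathCost w (b :: p) = pathCost w' (b :: p) := by
        refine pathCost_congr fun e h1 h2 => h e ?_ ?_
        · exact List.mem_cons_of_mem _ h1
        · simp only [List.tail_cons] at h2 ⊢
          exact List.mem_cons_of_mem _ h2
      simp only [pathCost, h1, h2]

theorem passesThrough_cons_cons {a b : Fin n} {p : List (Fin n)} {e : Edge n} :
    PassesThrough (a :: b :: p) e ↔ (e.1.1 = a ∧ e.1.2 = b) ∨ PassesThrough (b :: p) e := by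
  unfold PassesThrough
  rw [List.infix_cons_iff]
  simp [List.cons_prefix_cons]

theorem not_passesThrough_nil (e : Edge n) : ¬ PassesThrough [] e := by
  simp [PassesThrough]

theorem not_passesThrough_singleton (a : Fin n) (e : Edge n) : ¬ PassesThrough [a] e := by
  intro h
  have := List.IsInfix.length_le h
  simp at this

theorem PassesThrough.fst_mem {p : List (Fin n)} {e : Edge n} (h : PassesThrough p e) :
    e.1.1 ∈ p := h.subset (by simp)

open Classical in
/-- The set of edges of a path. -/
noncomputable def pathEdges (p : List (Fin n)) : Finset (Edge n) :=
  Finset.univ.filter (PassesThrough p)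

theorem mem_pathEdges {p : List (Fin n)} {e : Edge n} : e ∈ pathEdges p ↔ PassesThrough p e := by
  simp [pathEdges]

theorem pathEdges_nil : pathEdges ([] : List (Fin n)) = ∅ := by
  ext e; simp [mem_pathEdges, not_passesThrough_nil]

theorem pathEdges_singleton (a : Fin n) : pathEdges [a] = ∅ := by
  ext e; simp [mem_pathEdges, not_passesThrough_singleton]

theorem pathEdges_cons_cons {a b : Fin n} (h : a ≠ b) (p : List (Fin n)) :
    pathEdges (a :: b :: p) = insert ⟨(a, b), h⟩ (pathEdges (b :: p)) := by
  ext ⟨⟨c, d⟩, hcd⟩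
  simp [mem_pathEdges, passesThrough_cons_cons]

theorem notMem_pathEdges_of_notMem {a b : Fin n} (h : a ≠ b) {p : List (Fin n)} (ha : a ∉ p) :
    (⟨(a, b), h⟩ : Edge n) ∉ pathEdges p := by
  rw [mem_pathEdges]
  exact fun hp => ha hp.fst_mem

theorem pathCost_eq_sum (w : Edge n → ℝ) : ∀ {p : List (Fin n)}, p.Nodup →
    pathCost w p = ∑ e ∈ pathEdges p, w e
  | [], _ => by simp [pathCost, pathEdges_nil]
  | [_], _ => by simp [pathCost, pathEdges_singleton]
  | a :: b :: p, h => by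
      have hab : a ≠ b := by rintro rfl; simp at h
      rw [List.nodup_cons] at h
      rw [pathEdges_cons_cons hab, Finset.sum_insert (notMem_pathEdges_of_notMem hab h.1),
        ← pathCost_eq_sum w h.2, pathCost, edgeCost_of_ne w hab]

theorem card_pathEdges : ∀ {p : List (Fin n)}, p.Nodup → (pathEdges p).card = p.length - 1
  | [], _ => by simp [pathEdges_nil]
  | [_], _ => by simp [pathEdges_singleton]
  | a :: b :: p, h => by
      have hab : a ≠ b := by rintro rfl; simp at h
      rw [List.nodup_cons] at h
      rw [pathEdges_cons_cons hab, Finset.card_insert_of_notMem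
        (notMem_pathEdges_of_notMem hab h.1), card_pathEdges h.2]
      simp

/-- A path is an initial segment of every path that has the same first vertex and uses all of its
edges. -/
theorem prefix_of_pathEdges_subset : ∀ {p q : List (Fin n)}, p.Nodup → q.Nodup →
    p.head? = q.head? → pathEdges p ⊆ pathEdges q → p <+: q
  | [], _, _, _, _, _ => List.nil_prefix
  | [a], [], _, _, h, _ => by simp at h
  | [a], c :: q, _, _, h, _ => by
      simp only [List.head?_cons, Option.some.injEq] at h
      subst h
      simp [List.cons_prefix_cons]
  | a :: b :: p, [], _, _, h, _ => by simp at h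
  | a :: b :: p, [c], hp, _, h, hs => by
      have hab : a ≠ b := by rintro rfl; simp at hp
      have : (⟨(a, b), hab⟩ : Edge n) ∈ pathEdges [c] := hs (by simp [pathEdges_cons_cons hab])
      simp [pathEdges_singleton] at this
  | a :: b :: p, c :: d :: q, hp, hq, h, hs => by
      have hab : a ≠ b := by rintro rfl; simp at hp
      have hcd : c ≠ d := by rintro rfl; simp at hq
      simp only [List.head?_cons, Option.some.injEq] at h
      subst h
      rw [List.nodup_cons] at hp hq
      rw [pathEdges_cons_cons hab, pathEdges_cons_cons hcd, Finset.insert_subset_iff] at hs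
      have hbd : b = d := by
        have h1 := hs.1
        rw [Finset.mem_insert] at h1
        rcases h1 with h1 | h1
        · simpa using h1
        · exact absurd h1 (notMem_pathEdges_of_notMem hab hq.1)
      subst hbd
      rw [List.cons_prefix_cons]
      refine ⟨rfl, prefix_of_pathEdges_subset hp.2 hq.2 (by simp) fun e he => ?_⟩
      have h2 := hs.2 he
      rw [Finset.mem_insert] at h2
      rcases h2 with h2 | h2
      · subst h2
        exact absurd he (notMem_pathEdges_of_notMem hab hp.1)
      · exact h2

theorem eq_of_pathEdges_eq {p q : List (Fin n)} (hp : p.Nodup) (hq : q.Nodup)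
    (h : p.head? = q.head?) (hs : pathEdges p = pathEdges q) : p = q :=
  (prefix_of_pathEdges_subset hp hq h hs.subset).eq_of_length_le
    (prefix_of_pathEdges_subset hq hp h.symm hs.symm.subset).length_le

theorem finite_isPath : {p : List (Fin n) | IsPath p}.Finite :=
  (List.finite_length_le (Fin n) n).subset fun p hp => by
    simpa using hp.2.length_le_card

theorem IsPath.length_le {p : List (Fin n)} (hp : IsPath p) : p.length ≤ n := by
  simpa using hp.2.length_le_card

theorem exists_path (s t : Fin n) :
    ∃ p : List (Fin n), IsPath p ∧ p.head? = some s ∧ p.getLast? = some t := by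
  by_cases h : s = t
  · subst h
    exact ⟨[s], by simp [IsPath], rfl, rfl⟩
  · exact ⟨[s, t], by simp [IsPath, h], rfl, rfl⟩

theorem exists_shortestPath (w : Edge n → ℝ) (s t : Fin n) :
    ∃ p : List (Fin n), IsShortestPath w p ∧ p.head? = some s ∧ p.getLast? = some t := by
  have hf : {p : List (Fin n) | IsPath p ∧ p.head? = some s ∧ p.getLast? = some t}.Finite :=
    finite_isPath.subset fun p hp => hp.1
  obtain ⟨p, hp, hmin⟩ := Set.exists_min_image _ (pathCost w) hf (exists_path s t)
  refine ⟨p, ⟨hp.1, fun q hq h1 h2 => hmin q ⟨hq, ?_, ?_⟩⟩, hp.2⟩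
  · rw [h1, hp.2.1]
  · rw [h2, hp.2.2]

theorem isShortestPath_singleton {w : Edge n → ℝ} (hw : ∀ e, 0 ≤ w e) (v : Fin n) :
    IsShortestPath w [v] :=
  ⟨by simp [IsPath], fun q _ _ _ => pathCost_nonneg hw q⟩

/-- The set of shortest paths for the edge weights `w`. -/
def SP (w : Edge n → ℝ) : Set (List (Fin n)) := {p | IsShortestPath w p}

/-- The set of shortest paths that pass through the edge `e`. -/
def SPThrough (w : Edge n → ℝ) (e : Edge n) : Set (List (Fin n)) :=
  {p | p ∈ SP w ∧ PassesThrough p e}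

theorem IsPath.head_some {p : List (Fin n)} (hp : IsPath p) : ∃ s, p.head? = some s := by
  cases p with
  | nil => exact absurd rfl hp.1
  | cons a p => exact ⟨a, rfl⟩

theorem IsPath.getLast_some {p : List (Fin n)} (hp : IsPath p) : ∃ s, p.getLast? = some s :=
  ⟨_, List.getLast?_eq_some_getLast hp.1⟩

end Paths

/-! ### Counting locally shortest paths for fixed weights -/

section Counting

variable {n : ℕ} {w : Edge n → ℝ}

/-- No two different paths with the same first and the same last vertex have the same cost. -/
def HasUniqueCosts (w : Edge n → ℝ) : Prop :=
  ∀ p q : List (Fin n), IsPath p → IsPath q → p.head? = q.head? → p.getLast? = q.getLast? →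
    pathCost w p = pathCost w q → p = q

open Classical in
/-- The typical properties of random weights: any two vertices are joined by a path of cost at most
`r`, no vertex has more than `D` outgoing or more than `D` incoming edges of weight at most `r`, and
a path with `m` edges costs more than `r`. -/
structure IsTypical (w : Edge n → ℝ) (r : ℝ) (D m : ℕ) : Prop where
  dist_le : ∀ s t : Fin n, ∃ p, IsPath p ∧ p.head? = some s ∧ p.getLast? = some t ∧
    pathCost w p ≤ r
  out_le : ∀ v : Fin n, (Finset.univ.filter fun e : Edge n => e.1.1 = v ∧ w e ≤ r).card ≤ D
  in_le : ∀ v : Fin n, (Finset.univ.filter fun e : Edge n => e.1.2 = v ∧ w e ≤ r).card ≤ D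
  lt_cost : ∀ p : List (Fin n), IsPath p → p.length = m + 1 → r < pathCost w p

theorem finite_SP (w : Edge n → ℝ) : (SP w).Finite := finite_isPath.subset fun _ hp => hp.1

theorem finite_LSP (w : Edge n → ℝ) : (LSP w).Finite := finite_isPath.subset fun _ hp => hp.1

theorem IsShortestPath.eq_of_ends (hu : HasUniqueCosts w) {p q : List (Fin n)}
    (hp : IsShortestPath w p) (hq : IsShortestPath w q) (h1 : p.head? = q.head?)
    (h2 : p.getLast? = q.getLast?) : p = q :=
  hu p q hp.1 hq.1 h1 h2
    (le_antisymm (hp.2 q hq.1 h1.symm h2.symm) (hq.2 p hp.1 h1 h2))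

theorem ncard_SP_le (hu : HasUniqueCosts w) : (SP w).ncard ≤ n ^ 2 := by
  have h : (SP w).ncard ≤ (Set.image2 (fun s t : Fin n => (some s, some t))
      Set.univ Set.univ).ncard := by
    refine Set.ncard_le_ncard_of_injOn (fun p => (p.head?, p.getLast?)) ?_ ?_ (Set.toFinite _)
    · intro p hp
      obtain ⟨s, hs⟩ := hp.1.head_some
      obtain ⟨t, ht⟩ := hp.1.getLast_some
      exact ⟨s, trivial, t, trivial, by simp [hs, ht]⟩
    · intro p hp q hq h
      simp only [Prod.mk.injEq] at h
      exact hp.eq_of_ends hu hq h.1 h.2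
  refine h.trans ?_
  rw [← Set.image_prod]
  refine (Set.ncard_image_le (Set.toFinite _)).trans ?_
  simp [Set.ncard_univ, sq]

/-- A locally shortest path is determined by its first vertex and the shortest path left when its
first edge is deleted. -/
theorem ncard_LSP_le (hu : HasUniqueCosts w) : (LSP w).ncard ≤ n ^ 3 := by
  have h : (LSP w).ncard ≤ (Set.image2 (fun (s : Fin n) (q : List (Fin n)) => s :: q)
      Set.univ (SP w)).ncard := by
    refine Set.ncard_le_ncard ?_ (Set.Finite.image2 _ Set.finite_univ (finite_SP w))
    intro p hp
    cases p with
    | nil => exact absurd rfl hp.1.1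
    | cons a q => exact ⟨a, trivial, q, hp.2.1, rfl⟩
  refine h.trans ?_
  rw [← Set.image_prod]
  refine (Set.ncard_image_le ((Set.finite_univ).prod (finite_SP w))).trans ?_
  rw [Set.ncard_prod, Set.ncard_univ, Nat.card_eq_fintype_card, Fintype.card_fin, pow_succ' n 2]
  exact Nat.mul_le_mul_left _ (ncard_SP_le hu)

variable {r : ℝ} {D m : ℕ}

theorem IsTypical.cost_le (h : IsTypical w r D m) {p : List (Fin n)} (hp : IsShortestPath w p) :
    pathCost w p ≤ r := by
  obtain ⟨s, hs⟩ := hp.1.head_some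
  obtain ⟨t, ht⟩ := hp.1.getLast_some
  obtain ⟨q, hq, h1, h2, h3⟩ := h.dist_le s t
  exact (hp.2 q hq (by rw [h1, hs]) (by rw [h2, ht])).trans h3

theorem IsTypical.length_le (h : IsTypical w r D m) (hw : ∀ e, 0 ≤ w e) {p : List (Fin n)}
    (hp : IsShortestPath w p) : p.length ≤ m := by
  by_contra hlt
  have h1 : IsPath (p.take (m + 1)) := by
    refine ⟨?_, hp.1.2.sublist (List.take_sublist _ _)⟩
    simpa using hp.1.1
  have h2 := h.lt_cost _ h1 (by rw [List.length_take]; omega)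
  have h3 := pathCost_take_le hw p (m + 1)
  have h4 := h.cost_le hp
  linarith

theorem IsTypical.length_LSP_le (h : IsTypical w r D m) (hw : ∀ e, 0 ≤ w e) {p : List (Fin n)}
    (hp : p ∈ LSP w) : p.length ≤ m + 1 := by
  have := h.length_le hw hp.2.1
  rw [List.length_tail] at this
  omega

open Classical in
/-- The extensions of `q` by a new first edge of weight at most `r`. -/
noncomputable def leftExtensions (w : Edge n → ℝ) (r : ℝ) (q : List (Fin n)) :
    Finset (List (Fin n)) :=
  (Finset.univ.filter fun e : Edge n => some e.1.2 = q.head? ∧ w e ≤ r).image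
    fun e => e.1.1 :: q

open Classical in
/-- The extensions of `q` by a new last edge of weight at most `r`. -/
noncomputable def rightExtensions (w : Edge n → ℝ) (r : ℝ) (q : List (Fin n)) :
    Finset (List (Fin n)) :=
  (Finset.univ.filter fun e : Edge n => some e.1.1 = q.getLast? ∧ w e ≤ r).image
    fun e => q ++ [e.1.2]

theorem IsTypical.card_leftExtensions_le (h : IsTypical w r D m) {q : List (Fin n)}
    (hq : IsPath q) : (leftExtensions w r q).card ≤ D := by
  classical
  obtain ⟨s, hs⟩ := hq.head_some
  refine Finset.card_image_le.trans ?_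
  simpa [hs] using h.in_le s

theorem IsTypical.card_rightExtensions_le (h : IsTypical w r D m) {q : List (Fin n)}
    (hq : IsPath q) : (rightExtensions w r q).card ≤ D := by
  classical
  obtain ⟨s, hs⟩ := hq.getLast_some
  refine Finset.card_image_le.trans ?_
  simpa [hs] using h.out_le s

/-- The first edge of a locally shortest path with at least two edges lies on a shortest path, so
it has small weight. -/
theorem IsTypical.mem_leftExtensions (h : IsTypical w r D m) (hw : ∀ e, 0 ≤ w e)
    {p : List (Fin n)} (hp : p ∈ LSP w) (hl : 2 ≤ p.tail.length) :
    p ∈ leftExtensions w r p.tail := by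
  classical
  match p, hl with
  | a :: b :: c :: p, _ =>
    have hab : a ≠ b := by
      rintro rfl
      simpa using hp.1.2
    have h1 := h.cost_le hp.2.2
    simp only [List.dropLast, pathCost] at h1
    have h2 := pathCost_nonneg hw (b :: (c :: p).dropLast)
    rw [edgeCost_of_ne w hab] at h1
    simp only [leftExtensions, Finset.mem_image, Finset.mem_filter]
    exact ⟨⟨(a, b), hab⟩, ⟨Finset.mem_univ _, by simp, by linarith⟩, by simp⟩

/-- The counterpart of `IsTypical.mem_leftExtensions` for the last edge. -/
theorem IsTypical.mem_rightExtensions (h : IsTypical w r D m) (hw : ∀ e, 0 ≤ w e)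
    {p : List (Fin n)} (hp : p ∈ LSP w) (hl : 2 ≤ p.dropLast.length) :
    p ∈ rightExtensions w r p.dropLast := by
  classical
  obtain ⟨p, b, rfl⟩ : ∃ p' b, p = p' ++ [b] :=
    ⟨p.dropLast, p.getLast hp.1.1, (List.dropLast_append_getLast hp.1.1).symm⟩
  rw [List.dropLast_concat] at hl ⊢
  have hne : p ≠ [] := by rintro rfl; simp at hl
  obtain ⟨p, a, rfl⟩ : ∃ p' a, p = p' ++ [a] :=
    ⟨p.dropLast, p.getLast hne, (List.dropLast_append_getLast hne).symm⟩
  have hab : a ≠ b := by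
    rintro rfl
    have := hp.1.2
    simp [List.nodup_append] at this
  match p, hl with
  | c :: p, _ =>
    have h1 := h.cost_le hp.2.1
    simp only [List.cons_append, List.tail_cons, List.append_assoc, List.nil_append] at h1
    have h2 := edgeCost_le_pathCost_append hw a b p
    rw [edgeCost_of_ne w hab] at h2
    simp only [rightExtensions, Finset.mem_image, Finset.mem_filter]
    exact ⟨⟨(a, b), hab⟩, ⟨Finset.mem_univ _, by rw [List.getLast?_concat], by linarith⟩, by simp⟩

/-- Apart from the single edges, every locally shortest path is a shortest path extended by a light
edge. -/
theorem IsTypical.ncard_LSP_le (h : IsTypical w r D m) (hw : ∀ e, 0 ≤ w e)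
    (hu : HasUniqueCosts w) : (LSP w).ncard ≤ n ^ 2 + n ^ 2 * D := by
  classical
  have hsub : LSP w ⊆ (((Finset.univ : Finset (Fin n × Fin n)).image fun x => [x.1, x.2]) ∪
      (finite_SP w).toFinset.biUnion (leftExtensions w r) : Finset (List (Fin n))) := by
    intro p hp
    rw [Finset.coe_union]
    by_cases hl : 2 ≤ p.tail.length
    · right
      simp only [Finset.coe_biUnion, Set.mem_iUnion, Finset.mem_coe, Set.Finite.mem_toFinset]
      exact ⟨p.tail, hp.2.1, h.mem_leftExtensions hw hp hl⟩
    · left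
      match p, hl with
      | [], _ => exact absurd rfl hp.1.1
      | [a], _ => exact absurd rfl hp.2.1.1.1
      | [a, b], _ => simp
      | a :: b :: c :: p, hl => simp at hl
  refine (Set.ncard_le_ncard hsub (Finset.finite_toSet _)).trans ?_
  rw [Set.ncard_coe_finset]
  refine (Finset.card_union_le _ _).trans (add_le_add ?_ ?_)
  · refine Finset.card_image_le.trans ?_
    simp [sq]
  · refine (Finset.card_biUnion_le_card_mul _ _ D fun q hq => ?_).trans ?_
    · exact h.card_leftExtensions_le ((Set.Finite.mem_toFinset _).1 hq).1
    · rw [← Set.ncard_eq_toFinset_card _ (finite_SP w)]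
      exact Nat.mul_le_mul_right _ (ncard_SP_le hu)

theorem pathCost_update_of_not_passesThrough {e : Edge n} {x : ℝ} {p : List (Fin n)}
    (hp : p.Nodup) (h : ¬ PassesThrough p e) :
    pathCost (Function.update w e x) p = pathCost w p := by
  rw [pathCost_eq_sum _ hp, pathCost_eq_sum _ hp]
  refine Finset.sum_congr rfl fun e' he' => Function.update_of_ne ?_ _ _
  rintro rfl
  exact h (mem_pathEdges.1 he')

/-- If a shortest path avoiding `e` is no longer shortest after a change of the weight of `e`, then
every new shortest path between its ends passes through `e`. -/
theorem passesThrough_of_replaced {e : Edge n} {x : ℝ} {p q : List (Fin n)}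
    (hp : IsShortestPath w p) (hpe : ¬ PassesThrough p e)
    (hp' : ¬ IsShortestPath (Function.update w e x) p)
    (hq : IsShortestPath (Function.update w e x) q) (h1 : q.head? = p.head?)
    (h2 : q.getLast? = p.getLast?) : PassesThrough q e := by
  by_contra hqe
  refine hp' ⟨hp.1, fun q' hq' h1' h2' => ?_⟩
  rw [pathCost_update_of_not_passesThrough hp.1.2 hpe]
  refine (hp.2 q hq.1 h1 h2).trans ?_
  rw [← pathCost_update_of_not_passesThrough hq.1.2 hqe]
  exact hq.2 q' hq' (by rw [h1', h1]) (by rw [h2', h2])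

/-- Each replaced shortest path is sent to a new shortest path with the same ends, which determine
the old path. -/
theorem ncard_replaced_le (hu : HasUniqueCosts w) (e : Edge n) (x : ℝ) :
    {q | q ∈ SP w ∧ q ∉ SP (Function.update w e x) ∧ ¬ PassesThrough q e}.ncard ≤
      (SPThrough (Function.update w e x) e).ncard := by
  have key : ∀ p : List (Fin n), ∃ q, IsPath p → (IsShortestPath (Function.update w e x) q ∧
      q.head? = p.head? ∧ q.getLast? = p.getLast?) := by
    intro p
    by_cases hp : IsPath p
    · obtain ⟨s, hs⟩ := hp.head_some
      obtain ⟨t, ht⟩ := hp.getLast_some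
      rw [hs, ht]
      obtain ⟨q, hq⟩ := exists_shortestPath (Function.update w e x) s t
      exact ⟨q, fun _ => hq⟩
    · exact ⟨[], fun h => absurd h hp⟩
  choose f hf using key
  refine Set.ncard_le_ncard_of_injOn f ?_ ?_ ((finite_SP _).subset fun _ h => h.1)
  · rintro p ⟨hp, hp', hpe⟩
    obtain ⟨h0, h1, h2⟩ := hf p hp.1
    exact ⟨h0, passesThrough_of_replaced hp hpe hp' h0 h1 h2⟩
  · rintro p ⟨hp, -, -⟩ q ⟨hq, -, -⟩ hpq
    obtain ⟨-, h1, h2⟩ := hf p hp.1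
    obtain ⟨-, h3, h4⟩ := hf q hq.1
    exact hp.eq_of_ends hu hq (by rw [← h1, ← h3, hpq]) (by rw [← h2, ← h4, hpq])

/-- A locally shortest path that avoids `e` and is destroyed by a change of the weight of `e`
extends, by one light edge at one of its ends, a shortest path that has been replaced by a shortest
path through `e`. -/
theorem IsTypical.ncard_destroyed_le (h : IsTypical w r D m) (hw : ∀ e, 0 ≤ w e)
    (hu : HasUniqueCosts w) (e : Edge n) {x : ℝ} (hx : 0 ≤ x) :
    (LSPThrough w e ∪ (LSP w \ LSP (Function.update w e x))).ncard ≤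
      (LSPThrough w e).ncard + (SPThrough (Function.update w e x) e).ncard * (2 * D) := by
  classical
  have hw' : ∀ e', 0 ≤ Function.update w e x e' := by
    intro e'
    by_cases he : e' = e
    · subst he; simpa using hx
    · simpa [he] using hw e'
  set X := {q | q ∈ SP w ∧ q ∉ SP (Function.update w e x) ∧ ¬ PassesThrough q e} with hX
  have hXf : X.Finite := (finite_SP w).subset fun _ h => h.1
  have hlen : ∀ q ∈ X, 2 ≤ q.length := by
    rintro q ⟨hq, hq', -⟩
    match q with
    | [] => exact absurd rfl hq.1.1
    | [a] => exact absurd (isShortestPath_singleton hw' a) hq'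
    | a :: b :: q => simp
  have hsub : LSPThrough w e ∪ (LSP w \ LSP (Function.update w e x)) ⊆
      LSPThrough w e ∪ (hXf.toFinset.biUnion fun q => leftExtensions w r q ∪
        rightExtensions w r q : Finset (List (Fin n))) := by
    rintro p (hp | ⟨hp, hp'⟩)
    · exact Or.inl hp
    by_cases hpe : PassesThrough p e
    · exact Or.inl ⟨hp, hpe⟩
    right
    simp only [Finset.coe_biUnion, Set.mem_iUnion, Finset.mem_coe, Set.Finite.mem_toFinset,
      Finset.mem_union]
    by_cases ht : p.tail ∈ SP (Function.update w e x)
    · have hd : p.dropLast ∉ SP (Function.update w e x) := fun hd => hp' ⟨hp.1, ht, hd⟩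
      have hm : p.dropLast ∈ X :=
        ⟨hp.2.2, hd, fun hi => hpe (hi.trans (List.dropLast_prefix p).isInfix)⟩
      exact ⟨_, hm, Or.inr (h.mem_rightExtensions hw hp (hlen _ hm))⟩
    · have hm : p.tail ∈ X :=
        ⟨hp.2.1, ht, fun hi => hpe (hi.trans (List.tail_suffix p).isInfix)⟩
      exact ⟨_, hm, Or.inl (h.mem_leftExtensions hw hp (hlen _ hm))⟩
  refine (Set.ncard_le_ncard hsub (Set.Finite.union ((finite_LSP w).subset fun _ h => h.1)
    (Finset.finite_toSet _))).trans ?_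
  refine (Set.ncard_union_le _ _).trans (Nat.add_le_add_left ?_ _)
  rw [Set.ncard_coe_finset]
  refine (Finset.card_biUnion_le_card_mul _ _ (2 * D) fun q hq => ?_).trans
    (Nat.mul_le_mul_right _ ?_)
  · have hq' := ((Set.Finite.mem_toFinset _).1 hq).1.1
    refine (Finset.card_union_le _ _).trans ?_
    have := h.card_leftExtensions_le hq'
    have := h.card_rightExtensions_le hq'
    omega
  · rw [← Set.ncard_eq_toFinset_card _ hXf]
    exact ncard_replaced_le hu e x

/-- Double counting of the pairs of a path of `A` and an edge on it. -/
theorem sum_ncard_passesThrough_le {A : Set (List (Fin n))} (hA : ∀ p ∈ A, IsPath p) {M : ℕ}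
    (hM : ∀ p ∈ A, p.length ≤ M + 1) :
    ∑ e : Edge n, {p | p ∈ A ∧ PassesThrough p e}.ncard ≤ A.ncard * M := by
  classical
  have hAf : A.Finite := finite_isPath.subset hA
  have h1 : ∀ e : Edge n, {p | p ∈ A ∧ PassesThrough p e}.ncard =
      ∑ p ∈ hAf.toFinset, if e ∈ pathEdges p then 1 else 0 := by
    intro e
    rw [← Finset.sum_filter, ← Finset.card_eq_sum_ones, ← Set.ncard_coe_finset]
    congr 1
    ext p
    simp [mem_pathEdges]
  simp_rw [h1]
  rw [Finset.sum_comm, Set.ncard_eq_toFinset_card _ hAf, ← smul_eq_mul]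
  refine Finset.sum_le_card_nsmul _ _ _ fun p hp => ?_
  have hp' := (Set.Finite.mem_toFinset _).1 hp
  rw [← Finset.sum_filter, ← Finset.card_eq_sum_ones, Finset.filter_mem_eq_inter,
    Finset.univ_inter, card_pathEdges (hA p hp').2]
  have := hM p hp'
  omega

end Counting

/-! ### The product of uniform distributions -/

section Probability

variable {n : ℕ}

/-- The law of the random edge weights: independent and uniform on `[0, 1]`. -/
noncomputable abbrev weightLaw (n : ℕ) : Measure (Edge n → ℝ) :=
  Measure.pi fun _ : Edge n => uniform01

instance : IsProbabilityMeasure uniform01 := ⟨by simp [uniform01]⟩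

theorem ae_uniform01_mem : ∀ᵐ x ∂uniform01, x ∈ Set.Icc (0 : ℝ) 1 :=
  ae_restrict_mem measurableSet_Icc

theorem ae_weightLaw_mem : ∀ᵐ w ∂weightLaw n, ∀ e, w e ∈ Set.Icc (0 : ℝ) 1 := by
  rw [ae_all_iff]
  intro e
  exact (measurePreserving_eval (fun _ : Edge n => uniform01) e).quasiMeasurePreserving.ae
    ae_uniform01_mem

theorem uniform01_real_Iic {p : ℝ} (h0 : 0 ≤ p) (h1 : p ≤ 1) :
    uniform01.real (Set.Iic p) = p := by
  have : Set.Iic p ∩ Set.Icc (0 : ℝ) 1 = Set.Icc 0 p := by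
    ext x; simp only [Set.mem_inter_iff, Set.mem_Iic, Set.mem_Icc]
    constructor
    · rintro ⟨h1, h2, h3⟩; exact ⟨h2, h1⟩
    · rintro ⟨h2, h3⟩; exact ⟨h3, h2, h3.trans h1⟩
  rw [uniform01, measureReal_restrict_apply measurableSet_Iic, this]
  simp [Measure.real, h0]

theorem uniform01_real_Ioi {p : ℝ} (h0 : 0 ≤ p) (h1 : p ≤ 1) :
    uniform01.real (Set.Ioi p) = 1 - p := by
  rw [← Set.compl_Iic, probReal_compl_eq_one_sub measurableSet_Iic, uniform01_real_Iic h0 h1]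

theorem integral_uniform01_exp_le {c : ℝ} (hc : 0 < c) :
    ∫ x, Real.exp (-(c * x)) ∂uniform01 ≤ c⁻¹ := by
  have h1 : ∫ x, Real.exp (-(c * x)) ∂uniform01 = ∫ x in (0 : ℝ)..1, Real.exp ((-c) * x) := by
    rw [uniform01, integral_Icc_eq_integral_Ioc, ← intervalIntegral.integral_of_le zero_le_one]
    simp [neg_mul]
  rw [h1, intervalIntegral.integral_comp_mul_left (fun x => Real.exp x) (neg_ne_zero.2 hc.ne'),
    integral_exp]
  have := Real.exp_pos (-c * 1)
  have := inv_pos.2 hc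
  simp only [mul_zero, Real.exp_zero, smul_eq_mul, inv_neg]
  nlinarith

theorem integral_uniform01_ite {p : ℝ} (h0 : 0 ≤ p) (h1 : p ≤ 1) (a b : ℝ) :
    ∫ x, (if x ≤ p then a else b) ∂uniform01 = a * p + b * (1 - p) := by
  have h : (fun x : ℝ => if x ≤ p then a else b) =
      fun x => (Set.Iic p).indicator (fun _ => a) x + (Set.Ioi p).indicator (fun _ => b) x := by
    ext x
    by_cases hx : x ≤ p
    · simp [hx]
    · simp [hx, not_le.1 hx]
  rw [h, integral_add, integral_indicator_const _ measurableSet_Iic,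
    integral_indicator_const _ measurableSet_Ioi, uniform01_real_Iic h0 h1,
    uniform01_real_Ioi h0 h1]
  · simp only [smul_eq_mul]; ring
  · exact (integrable_const _).indicator measurableSet_Iic
  · exact (integrable_const _).indicator measurableSet_Ioi

theorem weightLaw_real_forall_lt (F : Finset (Edge n)) {p : ℝ} (h0 : 0 ≤ p) (h1 : p ≤ 1) :
    (weightLaw n).real {w | ∀ e ∈ F, p < w e} = (1 - p) ^ F.card := by
  classical
  have h : {w : Edge n → ℝ | ∀ e ∈ F, p < w e} =
      Set.univ.pi fun e => if e ∈ F then Set.Ioi p else Set.univ := by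
    ext w
    simp only [Set.mem_ofPred_eq, Set.mem_pi, Set.mem_univ, true_implies]
    refine forall_congr' fun e => ?_
    by_cases he : e ∈ F <;> simp [he]
  rw [h, Measure.real, Measure.pi_pi, ENNReal.toReal_prod]
  have : ∀ e, (uniform01 (if e ∈ F then Set.Ioi p else Set.univ)).toReal =
      if e ∈ F then (1 - p) else 1 := by
    intro e
    by_cases he : e ∈ F
    · simpa [he, Measure.real] using uniform01_real_Ioi h0 h1
    · simp [he]
  simp_rw [this]
  rw [Finset.prod_ite_mem, Finset.univ_inter, Finset.prod_const]

/-- Exponential Markov inequality for the number of light edges in a set of edges. -/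
theorem weightLaw_real_le_card_light (F : Finset (Edge n)) {p : ℝ} (h0 : 0 ≤ p) (h1 : p ≤ 1)
    (a : ℝ) : (weightLaw n).real {w | a ≤ ((F.filter fun e => w e ≤ p).card : ℝ)} ≤
      Real.exp (2 * p * F.card - a) := by
  classical
  have hX : ∀ w : Edge n → ℝ, Real.exp ((F.filter fun e => w e ≤ p).card : ℝ) =
      ∏ e : Edge n, (fun x : ℝ => if e ∈ F then (if x ≤ p then Real.exp 1 else 1) else 1) (w e) := by
    intro w
    simp only [Finset.prod_ite_mem, Finset.univ_inter]
    rw [← Finset.prod_filter, Finset.prod_const, ← Real.exp_nat_mul, mul_one]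
  have hI : ∫ w, Real.exp ((F.filter fun e => w e ≤ p).card : ℝ) ∂weightLaw n ≤
      Real.exp (2 * p * F.card) := by
    simp_rw [hX]
    rw [integral_fintype_prod_eq_prod (μ := fun _ : Edge n => uniform01)
      (fun (e : Edge n) (x : ℝ) => if e ∈ F then (if x ≤ p then Real.exp 1 else 1) else 1)]
    have h2 : ∀ e : Edge n, ∫ x, (if e ∈ F then (if x ≤ p then Real.exp 1 else 1) else 1)
        ∂uniform01 = if e ∈ F then Real.exp 1 * p + (1 - p) else 1 := by
      intro e
      by_cases he : e ∈ F
      · simp only [he, if_true]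
        rw [integral_uniform01_ite h0 h1, one_mul]
      · simp [he]
    simp_rw [h2]
    rw [Finset.prod_ite_mem, Finset.univ_inter, Finset.prod_const,
      mul_comm (2 * p), Real.exp_nat_mul]
    have h3 : Real.exp 1 ≤ 3 := Real.exp_one_lt_d9.le.trans (by norm_num)
    have h4 : 0 < Real.exp 1 := Real.exp_pos 1
    refine pow_le_pow_left₀ (by nlinarith) ?_ _
    have := Real.add_one_le_exp (2 * p)
    nlinarith
  have hm := mul_meas_ge_le_integral_of_nonneg (μ := weightLaw n)
    (f := fun w => Real.exp ((F.filter fun e => w e ≤ p).card : ℝ))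
    (ae_of_all _ fun w => (Real.exp_pos _).le) ?_ (Real.exp a)
  · simp only [Real.exp_le_exp] at hm
    rw [Real.exp_sub, le_div_iff₀ (Real.exp_pos a), mul_comm]
    exact hm.trans hI
  · refine Integrable.of_bound (C := Real.exp F.card) ?_ (ae_of_all _ fun w => ?_)
    · simp_rw [hX]
      refine (Finset.measurable_prod _ fun e _ => ?_).aestronglyMeasurable
      by_cases he : e ∈ F
      · simp only [he, if_true]
        exact Measurable.ite (measurableSet_le (measurable_pi_apply e) measurable_const)
          measurable_const measurable_const
      · simp [he]
    · rw [Real.norm_of_nonneg (Real.exp_pos _).le, Real.exp_le_exp]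
      exact_mod_cast Finset.card_filter_le _ _

/-- Exponential Markov inequality for the cost of a path. -/
theorem weightLaw_real_pathCost_le {p : List (Fin n)} (hp : IsPath p) {m : ℕ}
    (hm : p.length = m + 1) {c : ℝ} (hc : 0 < c) (r : ℝ) :
    (weightLaw n).real {w | pathCost w p ≤ r} ≤ Real.exp (c * r) * (c⁻¹) ^ m := by
  classical
  have hX : ∀ w : Edge n → ℝ, Real.exp (-(c * pathCost w p)) =
      ∏ e : Edge n, (fun x : ℝ => if e ∈ pathEdges p then Real.exp (-(c * x)) else 1) (w e) := by
    intro w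
    simp only [Finset.prod_ite_mem, Finset.univ_inter]
    rw [pathCost_eq_sum w hp.2, ← Real.exp_sum, Finset.mul_sum, Finset.sum_neg_distrib]
  have hI : ∫ w, Real.exp (-(c * pathCost w p)) ∂weightLaw n ≤ (c⁻¹) ^ m := by
    simp_rw [hX]
    rw [integral_fintype_prod_eq_prod (μ := fun _ : Edge n => uniform01)
      (fun (e : Edge n) (x : ℝ) => if e ∈ pathEdges p then Real.exp (-(c * x)) else 1)]
    have h2 : ∀ e : Edge n, ∫ x, (if e ∈ pathEdges p then Real.exp (-(c * x)) else 1)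
        ∂uniform01 = if e ∈ pathEdges p then ∫ x, Real.exp (-(c * x)) ∂uniform01 else 1 := by
      intro e
      by_cases he : e ∈ pathEdges p <;> simp [he]
    simp_rw [h2]
    rw [Finset.prod_ite_mem, Finset.univ_inter, Finset.prod_const, card_pathEdges hp.2, hm,
      Nat.add_sub_cancel]
    exact pow_le_pow_left₀ (integral_nonneg fun x => (Real.exp_pos _).le)
      (integral_uniform01_exp_le hc) _
  have hk := mul_meas_ge_le_integral_of_nonneg (μ := weightLaw n)
    (f := fun w => Real.exp (-(c * pathCost w p)))
    (ae_of_all _ fun w => (Real.exp_pos _).le) ?_ (Real.exp (-(c * r)))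
  · simp only [Real.exp_le_exp, neg_le_neg_iff, mul_le_mul_iff_right₀ hc] at hk
    have h3 := hk.trans hI
    rw [Real.exp_neg, inv_mul_le_iff₀ (Real.exp_pos _)] at h3
    exact h3
  · refine Integrable.of_bound (C := 1) ?_ ?_
    · simp_rw [pathCost_eq_sum _ hp.2]
      exact Measurable.aestronglyMeasurable (by fun_prop)
    · filter_upwards [ae_weightLaw_mem] with w hw
      rw [Real.norm_of_nonneg (Real.exp_pos _).le, Real.exp_le_one_iff, neg_nonpos]
      exact mul_nonneg hc.le (pathCost_nonneg (fun e => (hw e).1) p)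

theorem measurable_pathCost : ∀ p : List (Fin n), Measurable fun w : Edge n → ℝ => pathCost w p
  | [] => measurable_const
  | [_] => measurable_const
  | a :: b :: p => by
      have h1 : Measurable fun w : Edge n → ℝ => edgeCost w a b := by
        unfold edgeCost
        split_ifs
        · exact measurable_pi_apply _
        · exact measurable_const
      exact h1.add (measurable_pathCost (b :: p))

theorem weightLaw_absolutelyContinuous : weightLaw n ≪ (volume : Measure (Edge n → ℝ)) := by
  unfold weightLaw uniform01
  rw [volume_pi, ← Measure.restrict_pi_pi]
  exact Measure.restrict_le_self.absolutelyContinuous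

/-- Different sets of edges almost surely have different weights: the weights for which they do not
form a hyperplane. -/
theorem ae_sum_ne_sum {F F' : Finset (Edge n)} (h : F ≠ F') :
    ∀ᵐ w ∂weightLaw n, ∑ e ∈ F, w e ≠ ∑ e ∈ F', w e := by
  classical
  refine weightLaw_absolutelyContinuous.ae_le (?_ : ∀ᵐ w, _)
  let φ : (Edge n → ℝ) →ₗ[ℝ] ℝ := ∑ e ∈ F, LinearMap.proj e - ∑ e ∈ F', LinearMap.proj e
  have hφ : ∀ w, φ w = ∑ e ∈ F, w e - ∑ e ∈ F', w e := by
    intro w; simp [φ, LinearMap.sum_apply]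
  have hne : LinearMap.ker φ ≠ ⊤ := by
    intro htop
    obtain ⟨e, he⟩ : ∃ e, ¬ (e ∈ F ↔ e ∈ F') := by
      by_contra hcon
      push Not at hcon
      exact h (Finset.ext hcon)
    have h0 : φ (Pi.single e 1) = 0 := by
      have : Pi.single e (1 : ℝ) ∈ LinearMap.ker φ := by rw [htop]; trivial
      simpa using this
    rw [hφ] at h0
    simp only [Pi.single_apply, Finset.sum_ite_eq'] at h0
    by_cases h1 : e ∈ F <;> by_cases h2 : e ∈ F' <;> simp_all
  have := Measure.addHaar_submodule (volume : Measure (Edge n → ℝ)) (LinearMap.ker φ) hne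
  rw [ae_iff]
  convert this using 2
  ext w
  simp [hφ, sub_eq_zero]

theorem ae_hasUniqueCosts : ∀ᵐ w ∂weightLaw n, HasUniqueCosts w := by
  have key : ∀ᵐ w ∂weightLaw n, ∀ p q : List (Fin n), pathEdges p ≠ pathEdges q →
      ∑ e ∈ pathEdges p, w e ≠ ∑ e ∈ pathEdges q, w e := by
    rw [ae_all_iff]; intro p
    rw [ae_all_iff]; intro q
    by_cases h : pathEdges p = pathEdges q
    · exact ae_of_all _ fun w hw => absurd h hw
    · filter_upwards [ae_sum_ne_sum h] with w hw _ using hw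
  filter_upwards [key] with w hw p q hp hq h1 _ h3
  by_contra hne
  refine hw p q (fun he => hne (eq_of_pathEdges_eq hp.2 hq.2 h1 he)) ?_
  rwa [← pathCost_eq_sum w hp.2, ← pathCost_eq_sum w hq.2]

/-- Functions of the weights of disjoint sets of edges are independent. -/
theorem indepFun_of_dependsOn {β γ : Type*} [MeasurableSpace β] [MeasurableSpace γ]
    {f : (Edge n → ℝ) → β} {g : (Edge n → ℝ) → γ} {I J : Finset (Edge n)}
    (hf : Measurable f) (hg : Measurable g) (hfI : DependsOn f (I : Set (Edge n)))
    (hgJ : DependsOn g (J : Set (Edge n))) (hIJ : Disjoint I J) :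
    ProbabilityTheory.IndepFun f g (weightLaw n) := by
  classical
  have hind : ProbabilityTheory.iIndepFun (fun (e : Edge n) (w : Edge n → ℝ) => w e)
      (weightLaw n) :=
    ProbabilityTheory.iIndepFun_pi (X := fun _ x => x) fun _ => aemeasurable_id
  have hind' := hind.indepFun_finset I J hIJ fun e => measurable_pi_apply e
  let ext : (K : Finset (Edge n)) → (K → ℝ) → Edge n → ℝ :=
    fun K y e => if h : e ∈ K then y ⟨e, h⟩ else 0
  have hext : ∀ K, Measurable (ext K) := by
    intro K
    refine measurable_pi_lambda _ fun e => ?_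
    by_cases h : e ∈ K
    · simp only [ext, h, dite_true]; exact measurable_pi_apply _
    · simp only [ext, h, dite_false]; exact measurable_const
  have h2 := hind'.comp (hf.comp (hext I)) (hg.comp (hext J))
  convert h2 using 1
  · ext w
    exact hfI fun e he => by simp [ext, Finset.mem_coe.1 he]
  · ext w
    exact hgJ fun e he => by simp [ext, Finset.mem_coe.1 he]

end Probability

/-! ### Exploring the graph along light edges -/

section Exploration

variable {n : ℕ}

open Classical in
/-- The vertices of `U` that are reached from `S` by an edge of weight at most `p`. -/
noncomputable def lightNeighbors (S U : Finset (Fin n)) (p : ℝ) (w : Edge n → ℝ) :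
    Finset (Fin n) :=
  U.filter fun v => ∃ e : Edge n, e.1.1 ∈ S ∧ e.1.2 = v ∧ w e ≤ p

/-- Some vertex of `U` is not reached from `S`, through `U`, by a path of cost at most `r`. -/
def Unreached (S U : Finset (Fin n)) (r : ℝ) : Set (Edge n → ℝ) :=
  {w | ∃ t ∈ U, ∀ p : List (Fin n), IsPath p → (∃ s ∈ S, p.head? = some s) →
    p.getLast? = some t → (∀ v ∈ p.tail, v ∈ U) → r < pathCost w p}

theorem measurableSet_unreached (S U : Finset (Fin n)) (r : ℝ) :
    MeasurableSet (Unreached S U r) := by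
  unfold Unreached
  simp only [Set.ofPred_exists, Set.ofPred_and, Set.ofPred_forall]
  refine MeasurableSet.iUnion fun t => (MeasurableSet.const _).inter ?_
  refine MeasurableSet.iInter fun p => MeasurableSet.iInter fun _ => MeasurableSet.iInter fun _ =>
    MeasurableSet.iInter fun _ => MeasurableSet.iInter fun _ => ?_
  exact measurableSet_lt measurable_const (measurable_pathCost p)

open Classical in
/-- The edges from a vertex of `S` to a vertex of `U`. -/
noncomputable def edgesBetween (S U : Finset (Fin n)) : Finset (Edge n) :=
  Finset.univ.filter fun e => e.1.1 ∈ S ∧ e.1.2 ∈ U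

theorem mem_edgesBetween {S U : Finset (Fin n)} {e : Edge n} :
    e ∈ edgesBetween S U ↔ e.1.1 ∈ S ∧ e.1.2 ∈ U := by simp [edgesBetween]

theorem card_edgesBetween_singleton {S : Finset (Fin n)} {v : Fin n} (hv : v ∉ S) :
    (edgesBetween S {v}).card = S.card := by
  classical
  refine Finset.card_bij (fun e _ => e.1.1) (fun e he => (mem_edgesBetween.1 he).1) ?_ ?_
  · intro e he e' he' h
    have h1 := (mem_edgesBetween.1 he).2
    have h2 := (mem_edgesBetween.1 he').2
    rw [Finset.mem_singleton] at h1 h2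
    exact Subtype.ext (Prod.ext h (h1.trans h2.symm))
  · intro s hs
    exact ⟨⟨(s, v), fun h => hv ((show s = v from h) ▸ hs)⟩, by simp [mem_edgesBetween, hs], rfl⟩

theorem dependsOn_lightNeighbors (S U : Finset (Fin n)) (p : ℝ) :
    DependsOn (lightNeighbors S U p) (edgesBetween S U : Set (Edge n)) := by
  intro w w' h
  ext v
  simp only [lightNeighbors, Finset.mem_filter]
  refine and_congr_right fun hv => exists_congr fun e => and_congr_right fun he =>
    and_congr_right fun hev => ?_
  rw [h e (Finset.mem_coe.2 (mem_edgesBetween.2 ⟨he, hev ▸ hv⟩))]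

theorem dependsOn_unreached (S U : Finset (Fin n)) (r : ℝ) :
    DependsOn (fun w => w ∈ Unreached S U r) (edgesBetween (S ∪ U) U : Set (Edge n)) := by
  intro w w' h
  simp only [Unreached, Set.mem_ofPred_eq, eq_iff_iff]
  refine exists_congr fun t => and_congr_right fun _ => forall_congr' fun p =>
    forall_congr' fun hp => forall_congr' fun hs => forall_congr' fun _ => forall_congr' fun hU => ?_
  rw [pathCost_congr]
  intro e h1 h2
  refine h e (Finset.mem_coe.2 (mem_edgesBetween.2 ⟨?_, hU _ h2⟩))
  obtain ⟨s, hs, hps⟩ := hs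
  rw [Finset.mem_union]
  cases p with
  | nil => exact absurd rfl hp.1
  | cons a p =>
    simp only [List.head?_cons, Option.some.injEq] at hps
    rcases List.mem_cons.1 h1 with h1 | h1
    · exact Or.inl (h1 ▸ hps ▸ hs)
    · exact Or.inr (hU _ h1)

theorem measurable_lightNeighbors (S U : Finset (Fin n)) (p : ℝ) :
    @Measurable _ _ _ ⊤ (lightNeighbors S U p) := by
  let _ : MeasurableSpace (Finset (Fin n)) := ⊤
  refine measurable_to_countable' fun L => ?_
  have : lightNeighbors S U p ⁻¹' {L} = {w | ∀ v, (v ∈ U ∧ ∃ e : Edge n, e.1.1 ∈ S ∧ e.1.2 = v ∧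
      w e ≤ p) ↔ v ∈ L} := by
    ext w
    simp [lightNeighbors, Finset.ext_iff]
  rw [this, Set.ofPred_forall]
  refine MeasurableSet.iInter fun v => ?_
  have hm : MeasurableSet {w : Edge n → ℝ | v ∈ U ∧ ∃ e : Edge n, e.1.1 ∈ S ∧ e.1.2 = v ∧
      w e ≤ p} := by
    simp only [Set.ofPred_exists, Set.ofPred_and]
    refine (MeasurableSet.const _).inter (MeasurableSet.iUnion fun e =>
      (MeasurableSet.const _).inter ((MeasurableSet.const _).inter ?_))
    exact measurableSet_le (measurable_pi_apply e) measurable_const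
  by_cases hL : v ∈ L
  · simp only [hL, iff_true]
    exact hm
  · simp only [hL, iff_false]
    exact hm.compl

theorem measurable_lightNeighbors_comp {β : Type*} [MeasurableSpace β] (S U : Finset (Fin n))
    (p : ℝ) (f : Finset (Fin n) → β) : Measurable fun w => f (lightNeighbors S U p w) :=
  (@measurable_from_top _ _ _ f).comp (measurable_lightNeighbors S U p)

theorem measurableSet_lightNeighbors (S U : Finset (Fin n)) (p : ℝ) (P : Finset (Fin n) → Prop) :
    MeasurableSet {w | P (lightNeighbors S U p w)} :=
  measurable_lightNeighbors S U p (t := {L | P L}) trivial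

theorem weightLaw_real_mem_lightNeighbors {S : Finset (Fin n)} {v : Fin n} (hv : v ∉ S) {p : ℝ}
    (h0 : 0 ≤ p) (h1 : p ≤ 1) :
    (weightLaw n).real {w | v ∈ lightNeighbors S {v} p w} = 1 - (1 - p) ^ S.card := by
  have h := weightLaw_real_forall_lt (edgesBetween S {v}) h0 h1
  rw [card_edgesBetween_singleton hv] at h
  rw [← h, ← probReal_compl_eq_one_sub]
  · congr 1
    ext w
    simp only [lightNeighbors, mem_edgesBetween]
    simp
  · simp only [Set.ofPred_forall]
    exact MeasurableSet.iInter fun e => MeasurableSet.iInter fun _ =>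
      measurableSet_lt measurable_const (measurable_pi_apply e)

/-- The events that different vertices of `U` are reached from `S` are independent, each with
probability `1 - (1 - p) ^ S.card`. -/
theorem integral_exp_neg_card_lightNeighbors {S : Finset (Fin n)} {p : ℝ}
    (h0 : 0 ≤ p) (h1 : p ≤ 1) (U : Finset (Fin n)) (hU : Disjoint S U) :
    ∫ w, Real.exp (-((lightNeighbors S U p w).card : ℝ)) ∂weightLaw n ≤
      (1 - (1 - (1 - p) ^ S.card) / 2) ^ U.card := by
  classical
  set q := 1 - (1 - p) ^ S.card with hq
  have hq1 : q ≤ 1 := by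
    have : 0 ≤ (1 - p) ^ S.card := pow_nonneg (by linarith) _
    linarith
  induction U using Finset.induction_on with
  | empty => simp [lightNeighbors]
  | insert v U hv ih =>
    have hSU : Disjoint S U := hU.mono_right (Finset.subset_insert v U)
    have hvS : v ∉ S := fun h => (Finset.disjoint_left.1 hU h) (Finset.mem_insert_self v U)
    have hsplit : ∀ w : Edge n → ℝ, Real.exp (-((lightNeighbors S (insert v U) p w).card : ℝ)) =
        Real.exp (-((lightNeighbors S U p w).card : ℝ)) *
          Real.exp (-((lightNeighbors S {v} p w).card : ℝ)) := by
      intro w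
      rw [← Real.exp_add, ← neg_add, ← Nat.cast_add, ← Finset.card_union_of_disjoint]
      · congr 4
        ext u
        simp only [lightNeighbors, Finset.mem_filter, Finset.mem_union, Finset.mem_insert,
          Finset.mem_singleton]
        rw [or_and_right, or_comm]
      · refine Finset.disjoint_of_subset_left (Finset.filter_subset _ _) ?_
        refine Finset.disjoint_of_subset_right (Finset.filter_subset _ _) ?_
        simpa using hv
    have hind : ProbabilityTheory.IndepFun
        (fun w => Real.exp (-((lightNeighbors S U p w).card : ℝ)))
        (fun w => Real.exp (-((lightNeighbors S {v} p w).card : ℝ))) (weightLaw n) := by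
      refine indepFun_of_dependsOn
        (measurable_lightNeighbors_comp S U p fun L => Real.exp (-(L.card : ℝ)))
        (measurable_lightNeighbors_comp S {v} p fun L => Real.exp (-(L.card : ℝ)))
        (I := edgesBetween S U) (J := edgesBetween S {v}) ?_ ?_ ?_
      · intro w w' h
        simp only [dependsOn_lightNeighbors S U p h]
      · intro w w' h
        simp only [dependsOn_lightNeighbors S {v} p h]
      · rw [Finset.disjoint_left]
        intro e he he'
        have h1 := (mem_edgesBetween.1 he).2
        have h2 := (mem_edgesBetween.1 he').2
        rw [Finset.mem_singleton] at h2
        exact hv (h2 ▸ h1)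
    simp_rw [hsplit]
    rw [hind.integral_fun_mul_eq_mul_integral
      (measurable_lightNeighbors_comp S U p fun L => Real.exp (-(L.card : ℝ))).aestronglyMeasurable
      (measurable_lightNeighbors_comp S {v} p fun L =>
        Real.exp (-(L.card : ℝ))).aestronglyMeasurable, Finset.card_insert_of_notMem hv, pow_succ]
    refine mul_le_mul (ih hSU) ?_ (integral_nonneg fun w => (Real.exp_pos _).le)
      (pow_nonneg (by linarith) _)
    have hmeas := measurableSet_lightNeighbors S {v} p (fun L => v ∈ L)
    have hle : ∀ w : Edge n → ℝ, Real.exp (-((lightNeighbors S {v} p w).card : ℝ)) ≤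
        1 - {w | v ∈ lightNeighbors S {v} p w}.indicator (fun _ => (1 / 2 : ℝ)) w := by
      intro w
      by_cases hw : v ∈ lightNeighbors S {v} p w
      · have hc : 1 ≤ (lightNeighbors S {v} p w).card := Finset.card_pos.2 ⟨v, hw⟩
        have hc' : (1 : ℝ) ≤ (lightNeighbors S {v} p w).card := by exact_mod_cast hc
        rw [Set.indicator_of_mem (by exact hw)]
        have h3 : Real.exp (-((lightNeighbors S {v} p w).card : ℝ)) ≤ Real.exp (-1) :=
          Real.exp_le_exp.2 (by linarith)
        have h4 : Real.exp (-1) ≤ 1 / 2 := by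
          rw [Real.exp_neg, one_div]
          have := Real.add_one_le_exp 1
          gcongr
          linarith
        linarith
      · rw [Set.indicator_of_notMem (by exact hw), sub_zero, Real.exp_le_one_iff]
        simp
    calc _ ≤ ∫ w, (1 - {w | v ∈ lightNeighbors S {v} p w}.indicator (fun _ => (1 / 2 : ℝ)) w)
          ∂weightLaw n := by
          refine integral_mono_of_nonneg (ae_of_all _ fun w => (Real.exp_pos _).le) ?_
            (ae_of_all _ hle)
          exact (integrable_const _).sub ((integrable_const _).indicator hmeas)
      _ = 1 - q / 2 := by
          rw [integral_sub (integrable_const _) ((integrable_const _).indicator hmeas),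
            integral_indicator_const _ hmeas, weightLaw_real_mem_lightNeighbors hvS h0 h1]
          simp [hq, div_eq_mul_inv]

/-- Exponential Markov inequality for the number of vertices of `U` reached by light edges. -/
theorem weightLaw_real_card_lightNeighbors_lt {S U : Finset (Fin n)} {p : ℝ}
    (h0 : 0 ≤ p) (h1 : p ≤ 1) (hU : Disjoint S U) (a : ℝ) :
    (weightLaw n).real {w | ((lightNeighbors S U p w).card : ℝ) < a} ≤
      Real.exp (a - U.card * (1 - (1 - p) ^ S.card) / 2) := by
  have hI := integral_exp_neg_card_lightNeighbors h0 h1 U hU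
  set q := 1 - (1 - p) ^ S.card with hq
  have hq1 : q ≤ 1 := by
    have : 0 ≤ (1 - p) ^ S.card := pow_nonneg (by linarith) _
    linarith
  have hpow : (1 - q / 2) ^ U.card ≤ Real.exp (-(U.card * q / 2)) := by
    have : Real.exp (-(U.card * q / 2)) = Real.exp (-(q / 2)) ^ U.card := by
      rw [← Real.exp_nat_mul]; ring_nf
    rw [this]
    refine pow_le_pow_left₀ (by linarith) ?_ _
    have := Real.add_one_le_exp (-(q / 2))
    linarith
  have hm := mul_meas_ge_le_integral_of_nonneg (μ := weightLaw n)
    (f := fun w => Real.exp (-((lightNeighbors S U p w).card : ℝ)))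
    (ae_of_all _ fun w => (Real.exp_pos _).le) ?_ (Real.exp (-a))
  · simp only [Real.exp_le_exp, neg_le_neg_iff] at hm
    have h2 := (hm.trans hI).trans hpow
    rw [Real.exp_neg a, inv_mul_le_iff₀ (Real.exp_pos _), ← Real.exp_add, ← sub_eq_add_neg] at h2
    refine (measureReal_mono fun w hw => ?_).trans h2
    rw [Set.mem_ofPred_eq] at hw ⊢
    exact hw.le
  · refine Integrable.of_bound (C := 1)
      (measurable_lightNeighbors_comp S U p fun L =>
        Real.exp (-(L.card : ℝ))).aestronglyMeasurable (ae_of_all _ fun w => ?_)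
    rw [Real.norm_of_nonneg (Real.exp_pos _).le, Real.exp_le_one_iff]
    simp

/-- A path that leaves the light neighbours `L` of `S` through `U \ L` extends to a path from `S`
by a light edge. -/
theorem mem_unreached_lightNeighbors {S U : Finset (Fin n)} (hU : Disjoint S U) {p r : ℝ}
    (hr : 0 ≤ r) {w : Edge n → ℝ} (hw : w ∈ Unreached S U (r + p)) :
    w ∈ Unreached (lightNeighbors S U p w) (U \ lightNeighbors S U p w) r := by
  obtain ⟨t, htU, ht⟩ := hw
  have hstep : ∀ (v : Fin n) (q : List (Fin n)), v ∈ lightNeighbors S U p w → IsPath (v :: q) →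
      (v :: q).getLast? = some t → (∀ u ∈ q, u ∈ U) → r < pathCost w (v :: q) := by
    intro v q hv hq hqt hqU
    obtain ⟨hvU, ⟨⟨s, v'⟩, hsv⟩, hs, rfl, hwp⟩ := Finset.mem_filter.1 hv
    have h := ht (s :: v' :: q) ⟨by simp, ?_⟩ ⟨s, hs, rfl⟩ (by simpa using hqt) ?_
    · rw [pathCost, edgeCost_of_ne w hsv] at h
      linarith
    · refine List.nodup_cons.2 ⟨?_, hq.2⟩
      intro hmem
      refine Finset.disjoint_left.1 hU hs ?_
      rcases List.mem_cons.1 hmem with h | h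
      · exact h ▸ hvU
      · exact hqU s h
    · intro u hu
      rcases List.mem_cons.1 hu with h | h
      · exact h ▸ hvU
      · exact hqU u h
  have htN : t ∉ lightNeighbors S U p w := by
    intro htN
    have := hstep t [] htN (by simp [IsPath]) rfl (by simp)
    simp only [pathCost] at this
    linarith
  refine ⟨t, Finset.mem_sdiff.2 ⟨htU, htN⟩, fun q hq hqs hqt hqU => ?_⟩
  obtain ⟨v, hv, hqv⟩ := hqs
  cases q with
  | nil => exact absurd rfl hq.1
  | cons a q =>
    simp only [List.head?_cons, Option.some.injEq] at hqv
    subst hqv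
    exact hstep a q hv hq hqt fun u hu => (Finset.mem_sdiff.1 (hqU u hu)).1

/-- One round of exploration. The edges leaving `U` have not been inspected when the light
neighbours `L` of `S` in `U` are determined, so the exploration can go on from `L`. -/
theorem weightLaw_real_unreached_add_le {S U : Finset (Fin n)} (hU : Disjoint S U) {p r a b : ℝ}
    (hr : 0 ≤ r) (hb : 0 ≤ b)
    (h : ∀ L ⊆ U, a ≤ (L.card : ℝ) → (weightLaw n).real (Unreached L (U \ L) r) ≤ b) :
    (weightLaw n).real (Unreached S U (r + p)) ≤
      (weightLaw n).real {w | ((lightNeighbors S U p w).card : ℝ) < a} + b := by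
  classical
  set T := U.powerset.filter fun L => a ≤ (L.card : ℝ) with hT
  have hmE : ∀ L, MeasurableSet {w | lightNeighbors S U p w = L} := fun L =>
    measurableSet_lightNeighbors S U p (fun L' => L' = L)
  have hsub : Unreached S U (r + p) ⊆ {w | ((lightNeighbors S U p w).card : ℝ) < a} ∪
      ⋃ L ∈ T, ({w | lightNeighbors S U p w = L} ∩ Unreached L (U \ L) r) := by
    intro w hw
    by_cases ha : ((lightNeighbors S U p w).card : ℝ) < a
    · exact Or.inl ha
    · right
      simp only [Set.mem_iUnion]
      refine ⟨lightNeighbors S U p w, ?_, rfl, mem_unreached_lightNeighbors hU hr hw⟩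
      rw [hT, Finset.mem_filter, Finset.mem_powerset]
      exact ⟨Finset.filter_subset _ _, not_lt.1 ha⟩
  refine (measureReal_mono hsub).trans ((measureReal_union_le _ _).trans ?_)
  gcongr
  refine (measureReal_biUnion_finset_le _ _).trans ?_
  have hprod : ∀ L ∈ T, (weightLaw n).real ({w | lightNeighbors S U p w = L} ∩
      Unreached L (U \ L) r) ≤ (weightLaw n).real {w | lightNeighbors S U p w = L} * b := by
    intro L hL
    rw [hT, Finset.mem_filter, Finset.mem_powerset] at hL
    have hind : ProbabilityTheory.IndepFun (fun w => lightNeighbors S U p w = L)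
        (fun w => w ∈ Unreached L (U \ L) r) (weightLaw n) := by
      refine indepFun_of_dependsOn (I := edgesBetween S U)
        (J := edgesBetween (L ∪ (U \ L)) (U \ L)) ?_ ?_ ?_ (dependsOn_unreached _ _ _) ?_
      · exact measurable_lightNeighbors_comp S U p fun L' => L' = L
      · exact (measurable_mem).2 (measurableSet_unreached _ _ _)
      · intro w w' hww
        simp only [dependsOn_lightNeighbors S U p hww]
      · rw [Finset.disjoint_left]
        intro e he he'
        have h1 := (mem_edgesBetween.1 he).1
        have h2 := (mem_edgesBetween.1 he').1
        rw [Finset.union_sdiff_of_subset hL.1] at h2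
        exact Finset.disjoint_left.1 hU h1 h2
    have hi := hind.measure_inter_preimage_eq_mul {True} {True} trivial trivial
    have e1 : (fun w => lightNeighbors S U p w = L) ⁻¹' {True} =
        {w | lightNeighbors S U p w = L} := by ext w; simp
    have e2 : (fun w => w ∈ Unreached L (U \ L) r) ⁻¹' {True} = Unreached L (U \ L) r := by
      ext w; simp
    rw [e1, e2] at hi
    rw [Measure.real, hi, ENNReal.toReal_mul]
    exact mul_le_mul_of_nonneg_left (h L hL.1 hL.2) ENNReal.toReal_nonneg
  refine (Finset.sum_le_sum hprod).trans ?_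
  rw [← Finset.sum_mul]
  refine mul_le_of_le_one_left hb ?_
  rw [← measureReal_biUnion_finset]
  · exact measureReal_le_one
  · intro L _ L' _ hne
    exact Set.disjoint_left.2 fun w h1 h2 => hne (h1.symm.trans h2)
  · exact fun L _ => hmE L

end Exploration

/-! ### Random weights are typical -/

section Typical

variable {n : ℕ}

theorem unreached_antitone (S U : Finset (Fin n)) {r r' : ℝ} (h : r ≤ r') :
    Unreached S U r' ⊆ Unreached S U r := by
  rintro w ⟨t, htU, ht⟩
  exact ⟨t, htU, fun p hp hs hpt hpU => h.trans_lt (ht p hp hs hpt hpU)⟩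

/-- From a large set `S`, every vertex is reached by a single light edge. -/
theorem weightLaw_real_unreached_le {S U : Finset (Fin n)} (hU : Disjoint S U) {p : ℝ}
    (h0 : 0 ≤ p) (h1 : p ≤ 1) :
    (weightLaw n).real (Unreached S U p) ≤ n * Real.exp (-(p * S.card)) := by
  have hsub : Unreached S U p ⊆ ⋃ t ∈ U, {w | ∀ e ∈ edgesBetween S {t}, p < w e} := by
    rintro w ⟨t, htU, ht⟩
    simp only [Set.mem_iUnion]
    refine ⟨t, htU, ?_⟩
    rintro ⟨⟨s, t'⟩, hst⟩ he
    obtain ⟨hs, ht'⟩ := mem_edgesBetween.1 he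
    rw [Finset.mem_singleton] at ht'
    simp only at hs ht'
    subst ht'
    have hne : s ≠ t' := hst
    have := ht [s, t'] (by simp [IsPath, hne]) ⟨s, hs, rfl⟩ rfl (by simpa using htU)
    simpa [pathCost, edgeCost_of_ne w hne] using this
  refine (measureReal_mono hsub (measure_ne_top _ _)).trans ((measureReal_biUnion_finset_le _ _).trans ?_)
  have hle : ∀ t ∈ U, (weightLaw n).real {w | ∀ e ∈ edgesBetween S {t}, p < w e} ≤
      Real.exp (-(p * S.card)) := by
    intro t ht
    rw [weightLaw_real_forall_lt _ h0 h1,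
      card_edgesBetween_singleton (fun h => Finset.disjoint_left.1 hU h ht)]
    have : Real.exp (-(p * S.card)) = Real.exp (-p) ^ S.card := by
      rw [← Real.exp_nat_mul]; ring_nf
    rw [this]
    refine pow_le_pow_left₀ (by linarith) ?_ _
    have := Real.add_one_le_exp (-p)
    linarith
  refine (Finset.sum_le_sum hle).trans ?_
  rw [Finset.sum_const, nsmul_eq_mul]
  have : (U.card : ℝ) ≤ n := by exact_mod_cast (card_finset_fin_le U)
  gcongr

theorem half_le_one_sub_one_sub_pow {p : ℝ} (h0 : 0 ≤ p) (h1 : p ≤ 1) {k : ℕ} (hk : p * k ≤ 1) :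
    p * k / 2 ≤ 1 - (1 - p) ^ k := by
  set x := p * k with hx
  have hx0 : 0 ≤ x := by positivity
  have h2 : (1 - p) ^ k ≤ Real.exp (-x) := by
    have : Real.exp (-x) = Real.exp (-p) ^ k := by
      rw [← Real.exp_nat_mul, hx]; ring_nf
    rw [this]
    refine pow_le_pow_left₀ (by linarith) ?_ _
    have := Real.add_one_le_exp (-p)
    linarith
  have h3 : Real.exp (-x) ≤ 1 - x / 2 := by
    rw [Real.exp_neg, inv_le_comm₀ (Real.exp_pos _) (by linarith)]
    have := Real.add_one_le_exp x
    refine le_trans ?_ this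
    rw [inv_le_iff_one_le_mul₀ (by linarith)]
    nlinarith
  linarith

/-- Once `S` has at least logarithmic size, the explored set doubles in every round that uses edges
of weight at most `24 / n`, until it contains a constant fraction of the vertices. Then one round
with edges of logarithmically larger weight reaches all remaining vertices. The hypothesis
`n ≤ U.card + 2 * S.card` says that at most `2 * S.card` vertices have been explored; it is preserved
by doubling and leaves most vertices in `U` while `S` is small. The number `m` bounds the doublings
that are still needed. -/
theorem weightLaw_real_unreached_doubling_le (hn : 24 ≤ n) (hl : 144 * Real.log n ≤ n) (m : ℕ) :
    ∀ S U : Finset (Fin n), Disjoint S U → n ≤ U.card + 2 * S.card →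
      5 * Real.log n ≤ S.card → n ≤ 24 * 2 ^ m * S.card →
      (weightLaw n).real (Unreached S U (144 * Real.log n / n + m * (24 / n))) ≤
        (m + 1) * Real.exp (-(5 * Real.log n)) := by
  have hn0 : (0 : ℝ) < n := by exact_mod_cast (by omega : 0 < n)
  have hn24 : (24 : ℝ) ≤ n := by exact_mod_cast hn
  have hl0 : 0 ≤ Real.log n := Real.log_nonneg (by linarith)
  have hfinal : ∀ (j : ℕ) (S U : Finset (Fin n)), Disjoint S U → n ≤ 24 * S.card →
      (weightLaw n).real (Unreached S U (144 * Real.log n / n + j * (24 / n))) ≤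
        Real.exp (-(5 * Real.log n)) := by
    intro j S U hU hS
    have hS' : (n : ℝ) ≤ 24 * S.card := by exact_mod_cast hS
    refine (measureReal_mono (unreached_antitone S U (r := 144 * Real.log n / n) ?_)).trans ?_
    · have : (0 : ℝ) ≤ j * (24 / n) := by positivity
      linarith
    refine (weightLaw_real_unreached_le hU (by positivity) ((div_le_one hn0).2 hl)).trans ?_
    have h1 : (n : ℝ) = Real.exp (Real.log n) := (Real.exp_log hn0).symm
    have h2 : 6 * Real.log n ≤ 144 * Real.log n / n * S.card := by
      rw [div_mul_eq_mul_div, le_div_iff₀ hn0]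
      nlinarith
    calc (n : ℝ) * Real.exp (-(144 * Real.log n / n * S.card))
        = Real.exp (Real.log n + -(144 * Real.log n / n * S.card)) := by
          rw [Real.exp_add, ← h1]
      _ ≤ _ := Real.exp_le_exp.2 (by linarith)
  induction m with
  | zero =>
    intro S U hU _ _ hS
    have := hfinal 0 S U hU (by simpa using hS)
    simpa using this
  | succ m ih =>
    intro S U hU hUS hS5 hS
    by_cases hbig : n ≤ 24 * S.card
    · refine (hfinal (m + 1) S U hU hbig).trans ?_
      have : (1 : ℝ) ≤ ((m + 1 : ℕ) : ℝ) + 1 := by push_cast; linarith [Nat.cast_nonneg (α := ℝ) m]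
      exact le_mul_of_one_le_left (Real.exp_pos _).le this
    have hsmall : (24 * S.card : ℝ) ≤ n := by exact_mod_cast (not_le.1 hbig).le
    have hUS' : (n : ℝ) ≤ U.card + 2 * S.card := by exact_mod_cast hUS
    have hp0 : (0 : ℝ) ≤ 24 / n := by positivity
    have hp1 : (24 : ℝ) / n ≤ 1 := (div_le_one hn0).2 hn24
    have hr : (144 * Real.log n / n + (m + 1 : ℕ) * (24 / n) : ℝ) =
        (144 * Real.log n / n + m * (24 / n)) + 24 / n := by push_cast; ring
    rw [hr]
    refine (weightLaw_real_unreached_add_le hU (a := 2 * S.card)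
      (b := (m + 1) * Real.exp (-(5 * Real.log n))) (by positivity) (by positivity) ?_).trans ?_
    · intro L hL hLa
      have hLa' : 2 * S.card ≤ L.card := by exact_mod_cast hLa
      have hc : (U \ L).card = U.card - L.card := Finset.card_sdiff_of_subset hL
      have hc' := Finset.card_le_card hL
      refine ih L (U \ L) Finset.disjoint_sdiff (by omega) (by linarith) ?_
      calc n ≤ 24 * 2 ^ (m + 1) * S.card := hS
        _ = 24 * 2 ^ m * (2 * S.card) := by ring
        _ ≤ 24 * 2 ^ m * L.card := Nat.mul_le_mul_left _ hLa'
    -- As `U` contains at least `22 / 24` of the vertices, the exponent in the bound on the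
    -- probability that `S` fails to double is at most `(2 - 11 / 2) * S.card`.
    · have h1 := weightLaw_real_card_lightNeighbors_lt hp0 hp1 hU (2 * S.card)
      have h2 := half_le_one_sub_one_sub_pow hp0 hp1 (k := S.card)
        (by rw [div_mul_eq_mul_div]; exact (div_le_one hn0).2 hsmall)
      have h3 : (22 * S.card / 2 : ℝ) ≤ U.card * (1 - (1 - 24 / (n : ℝ)) ^ S.card) := by
        have h4 : (22 / 24 : ℝ) * n ≤ U.card := by linarith
        calc (22 * S.card / 2 : ℝ) = (22 / 24 : ℝ) * n * (24 / n * S.card / 2) := by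
              field_simp
          _ ≤ _ := mul_le_mul h4 h2 (by positivity) (by positivity)
      have h5 : Real.exp (2 * S.card - U.card * (1 - (1 - 24 / (n : ℝ)) ^ S.card) / 2) ≤
          Real.exp (-(5 * Real.log n)) := Real.exp_le_exp.2 (by linarith)
      push_cast
      linarith

/-- From any vertex, a round with edges of logarithmic weight reaches logarithmically many vertices;
then the explored set starts to double. -/
theorem weightLaw_real_unreached_singleton_le (hn : 24 ≤ n) (h1l : 1 ≤ Real.log n)
    (hl : 144 * Real.log n ≤ n) (s : Fin n) :
    (weightLaw n).real (Unreached {s} (Finset.univ \ {s}) (256 * Real.log n / n)) ≤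
      Real.exp (-(4 * Real.log n)) := by
  have hn0 : (0 : ℝ) < n := by exact_mod_cast (by omega : 0 < n)
  set m := Nat.clog 2 n with hm
  have hm1 : n ≤ 2 ^ m := Nat.le_pow_clog (by norm_num) n
  have hm2 : (m : ℝ) ≤ 3 * Real.log n := by
    have h1 : 2 ^ m.pred < n := Nat.pow_pred_clog_lt_self (by norm_num) (by omega)
    have h2 : ((2 : ℝ)) ^ m.pred < n := by exact_mod_cast h1
    have h3 := Real.log_lt_log (by positivity) h2
    rw [Real.log_pow] at h3
    have h4 := Real.log_two_gt_d9
    have h5 : (m : ℝ) ≤ m.pred + 1 := by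
      have h6 : m ≤ m.pred + 1 := by rw [Nat.pred_eq_sub_one]; omega
      exact_mod_cast h6
    nlinarith
  have hdisj : Disjoint ({s} : Finset (Fin n)) (Finset.univ \ {s}) := Finset.disjoint_sdiff
  have hp0 : 0 ≤ 40 * Real.log n / n := by positivity
  have hp1 : 40 * Real.log n / n ≤ 1 := (div_le_one hn0).2 (by linarith)
  have hcard : (Finset.univ \ {s} : Finset (Fin n)).card = n - 1 := by
    rw [Finset.card_sdiff_of_subset (Finset.subset_univ _)]; simp
  refine (measureReal_mono (unreached_antitone _ _
    (r := (144 * Real.log n / n + m * (24 / n)) + 40 * Real.log n / n) ?_)).trans ?_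
  · have : (m : ℝ) * (24 / n) ≤ 72 * Real.log n / n := by
      rw [mul_div_assoc', div_le_div_iff_of_pos_right hn0]
      linarith
    calc _ ≤ (144 * Real.log n / n + 72 * Real.log n / n) + 40 * Real.log n / n := by gcongr
      _ = 256 * Real.log n / n := by ring
  refine (weightLaw_real_unreached_add_le hdisj (a := 5 * Real.log n)
    (b := (m + 1) * Real.exp (-(5 * Real.log n))) (by positivity) (by positivity) ?_).trans ?_
  · intro L hL hLa
    have hL0 : 1 ≤ L.card := by
      have : (0 : ℝ) < L.card := by linarith
      exact_mod_cast this
    have hc := Finset.card_sdiff_of_subset hL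
    have hc' := Finset.card_le_card hL
    refine weightLaw_real_unreached_doubling_le hn hl m L _ Finset.disjoint_sdiff (by omega) hLa ?_
    calc n ≤ 2 ^ m * 1 := by simpa using hm1
      _ ≤ 2 ^ m * (24 * L.card) := Nat.mul_le_mul_left _ (by omega)
      _ = _ := by ring
  · have h1 := weightLaw_real_card_lightNeighbors_lt hp0 hp1 hdisj (5 * Real.log n)
    rw [hcard, Finset.card_singleton, pow_one, sub_sub_cancel, Nat.cast_sub (by omega),
      Nat.cast_one] at h1
    have h2 : 10 * Real.log n ≤ ((n : ℝ) - 1) * (40 * Real.log n / n) / 2 := by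
      rw [mul_div_assoc', div_div, le_div_iff₀ (by positivity)]
      nlinarith
    have h3 : Real.exp (5 * Real.log n - ((n : ℝ) - 1) * (40 * Real.log n / n) / 2) ≤
        Real.exp (-(5 * Real.log n)) := Real.exp_le_exp.2 (by linarith)
    have h4 : (m + 2) * Real.exp (-(5 * Real.log n)) ≤ Real.exp (-(4 * Real.log n)) := by
      calc (m + 2) * Real.exp (-(5 * Real.log n))
          ≤ n * Real.exp (-(5 * Real.log n)) := by gcongr; linarith
        _ = Real.exp (Real.log n + -(5 * Real.log n)) := by rw [Real.exp_add, Real.exp_log hn0]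
        _ = _ := by ring_nf
    linarith

theorem weightLaw_real_exists_far_le (hn : 24 ≤ n) (h1l : 1 ≤ Real.log n)
    (hl : 144 * Real.log n ≤ n) :
    (weightLaw n).real {w | ¬ ∀ s t : Fin n, ∃ p, IsPath p ∧ p.head? = some s ∧
      p.getLast? = some t ∧ pathCost w p ≤ 256 * Real.log n / n} ≤
      Real.exp (-(3 * Real.log n)) := by
  have hn0 : (0 : ℝ) < n := by exact_mod_cast (by omega : 0 < n)
  have hsub : {w | ¬ ∀ s t : Fin n, ∃ p, IsPath p ∧ p.head? = some s ∧
      p.getLast? = some t ∧ pathCost w p ≤ 256 * Real.log n / n} ⊆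
      ⋃ s ∈ (Finset.univ : Finset (Fin n)),
        Unreached {s} (Finset.univ \ {s}) (256 * Real.log n / n) := by
    intro w hw
    rw [Set.mem_ofPred_eq] at hw
    push Not at hw
    obtain ⟨s, t, hst⟩ := hw
    simp only [Set.mem_iUnion]
    refine ⟨s, Finset.mem_univ s, t, ?_, ?_⟩
    · rw [Finset.mem_sdiff, Finset.mem_singleton]
      refine ⟨Finset.mem_univ _, ?_⟩
      rintro rfl
      have := hst [t] (by simp [IsPath]) rfl rfl
      simp only [pathCost] at this
      have h0 : 0 ≤ 256 * Real.log n / n := by positivity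
      linarith
    · intro p hp hs hpt _
      obtain ⟨s', hs', hps⟩ := hs
      rw [Finset.mem_singleton] at hs'
      exact hst p hp (hs' ▸ hps) hpt
  refine (measureReal_mono hsub (measure_ne_top _ _)).trans ((measureReal_biUnion_finset_le _ _).trans ?_)
  refine (Finset.sum_le_sum fun s _ =>
    weightLaw_real_unreached_singleton_le hn h1l hl s).trans ?_
  rw [Finset.sum_const, nsmul_eq_mul, Finset.card_univ, Fintype.card_fin]
  refine le_of_eq ?_
  calc (n : ℝ) * Real.exp (-(4 * Real.log n))
      = Real.exp (Real.log n + -(4 * Real.log n)) := by rw [Real.exp_add, Real.exp_log hn0]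
    _ = _ := by ring_nf

theorem weightLaw_real_lt_card_light_le (hn : 24 ≤ n) (hl : 256 * Real.log n ≤ n)
    {F : Finset (Edge n)} (hF : F.card ≤ n) :
    (weightLaw n).real {w | ¬ (F.filter fun e => w e ≤ 256 * Real.log n / n).card ≤
      ⌈516 * Real.log n⌉₊} ≤ Real.exp (-(4 * Real.log n)) := by
  have hn0 : (0 : ℝ) < n := by exact_mod_cast (by omega : 0 < n)
  have hF' : (F.card : ℝ) ≤ n := by exact_mod_cast hF
  have h := weightLaw_real_le_card_light F (p := 256 * Real.log n / n) (by positivity)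
    ((div_le_one hn0).2 hl) (516 * Real.log n)
  refine (measureReal_mono ?_).trans (h.trans ?_)
  · intro w hw
    rw [Set.mem_ofPred_eq] at hw ⊢
    exact (Nat.le_ceil _).trans (by exact_mod_cast (not_le.1 hw).le)
  · refine Real.exp_le_exp.2 ?_
    have : 2 * (256 * Real.log n / n) * F.card ≤ 512 * Real.log n := by
      calc 2 * (256 * Real.log n / n) * F.card ≤ 2 * (256 * Real.log n / n) * n := by gcongr
        _ = 512 * Real.log n := by field_simp; ring
    linarith

/-- There are at most `n ^ (m + 1)` paths with `m` edges, and each of them is cheap with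
probability at most `exp (3 * n * r) / (3 * n) ^ m`. -/
theorem weightLaw_real_exists_long_le (hn : 24 ≤ n) :
    (weightLaw n).real {w | ¬ ∀ p : List (Fin n), IsPath p →
      p.length = ⌈773 * Real.log n⌉₊ + 1 → 256 * Real.log n / n < pathCost w p} ≤
      Real.exp (-(3 * Real.log n)) := by
  have hn0 : (0 : ℝ) < n := by exact_mod_cast (by omega : 0 < n)
  have hl0 : 0 ≤ Real.log n := Real.log_natCast_nonneg n
  set m := ⌈773 * Real.log n⌉₊ with hm
  have hm' : 773 * Real.log n ≤ m := Nat.le_ceil _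
  have hsub : {w : Edge n → ℝ | ¬ ∀ p : List (Fin n), IsPath p →
      p.length = m + 1 → 256 * Real.log n / n < pathCost w p} ⊆
      ⋃ f ∈ (Finset.univ : Finset (Fin (m + 1) → Fin n)),
        {w | IsPath (List.ofFn f) ∧ pathCost w (List.ofFn f) ≤ 256 * Real.log n / n} := by
    intro w hw
    rw [Set.mem_ofPred_eq] at hw
    push Not at hw
    obtain ⟨p, hp, hpl, hpc⟩ := hw
    simp only [Set.mem_iUnion]
    refine ⟨fun i => p.get (i.cast hpl.symm), Finset.mem_univ _, ?_⟩
    have : List.ofFn (fun i : Fin (m + 1) => p.get (i.cast hpl.symm)) = p := by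
      rw [← List.ofFn_congr hpl, List.ofFn_get]
    rw [Set.mem_ofPred_eq, this]
    exact ⟨hp, hpc⟩
  refine (measureReal_mono hsub (measure_ne_top _ _)).trans ((measureReal_biUnion_finset_le _ _).trans ?_)
  have hone : ∀ f : Fin (m + 1) → Fin n, (weightLaw n).real {w | IsPath (List.ofFn f) ∧
      pathCost w (List.ofFn f) ≤ 256 * Real.log n / n} ≤
      Real.exp (768 * Real.log n) * ((3 * (n : ℝ))⁻¹) ^ m := by
    intro f
    by_cases hf : IsPath (List.ofFn f)
    · have h := weightLaw_real_pathCost_le hf (m := m) (by simp) (c := 3 * n) (by positivity)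
        (256 * Real.log n / n)
      have h2 : 3 * (n : ℝ) * (256 * Real.log n / n) = 768 * Real.log n := by field_simp; ring
      rw [h2] at h
      simpa only [hf, true_and] using h
    · simp only [hf, false_and, Set.ofPred_false, measureReal_empty]
      positivity
  refine (Finset.sum_le_sum fun f _ => hone f).trans ?_
  rw [Finset.sum_const, nsmul_eq_mul, Finset.card_univ, Fintype.card_fun, Fintype.card_fin,
    Fintype.card_fin, Nat.cast_pow]
  have h3 : ((3 : ℝ)⁻¹) ^ m ≤ Real.exp (-(773 * Real.log n)) := by
    calc ((3 : ℝ)⁻¹) ^ m ≤ (Real.exp (-1)) ^ m := by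
          refine pow_le_pow_left₀ (by norm_num) ?_ _
          rw [Real.exp_neg]
          gcongr
          exact Real.exp_one_lt_d9.le.trans (by norm_num)
      _ = Real.exp (-(m : ℝ)) := by rw [← Real.exp_nat_mul]; ring_nf
      _ ≤ _ := Real.exp_le_exp.2 (by linarith)
  calc (n : ℝ) ^ (m + 1) * (Real.exp (768 * Real.log n) * ((3 * (n : ℝ))⁻¹) ^ m)
      = n * Real.exp (768 * Real.log n) * ((3 : ℝ)⁻¹) ^ m := by
        rw [mul_inv, mul_pow, pow_succ, inv_pow (n : ℝ)]
        field_simp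
    _ ≤ n * Real.exp (768 * Real.log n) * Real.exp (-(773 * Real.log n)) := by gcongr
    _ = Real.exp (Real.log n + 768 * Real.log n + -(773 * Real.log n)) := by
        rw [Real.exp_add, Real.exp_add, Real.exp_log hn0]
    _ ≤ _ := Real.exp_le_exp.2 (by linarith)

/-- The four properties of typical weights fail with probability at most `n⁻³` each. -/
theorem weightLaw_real_not_isTypical_le (hn : 24 ≤ n) (h1l : 1 ≤ Real.log n)
    (hl : 256 * Real.log n ≤ n) :
    (weightLaw n).real {w | ¬ IsTypical w (256 * Real.log n / n) ⌈516 * Real.log n⌉₊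
      ⌈773 * Real.log n⌉₊} ≤ 4 * Real.exp (-(3 * Real.log n)) := by
  classical
  have hn0 : (0 : ℝ) < n := by exact_mod_cast (by omega : 0 < n)
  have hdeg : ∀ F : Fin n → Finset (Edge n), (∀ v, (F v).card ≤ n) →
      (weightLaw n).real {w | ¬ ∀ v, ((F v).filter fun e => w e ≤ 256 * Real.log n / n).card ≤
        ⌈516 * Real.log n⌉₊} ≤ Real.exp (-(3 * Real.log n)) := by
    intro F hF
    have hsub : {w : Edge n → ℝ | ¬ ∀ v, ((F v).filter fun e =>
        w e ≤ 256 * Real.log n / n).card ≤ ⌈516 * Real.log n⌉₊} ⊆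
        ⋃ v ∈ (Finset.univ : Finset (Fin n)), {w | ¬ ((F v).filter fun e =>
          w e ≤ 256 * Real.log n / n).card ≤ ⌈516 * Real.log n⌉₊} := by
      intro w hw
      rw [Set.mem_ofPred_eq, not_forall] at hw
      obtain ⟨v, hv⟩ := hw
      simp only [Set.mem_iUnion]
      exact ⟨v, Finset.mem_univ v, hv⟩
    refine (measureReal_mono hsub (measure_ne_top _ _)).trans ((measureReal_biUnion_finset_le _ _).trans ?_)
    refine (Finset.sum_le_sum fun v _ => weightLaw_real_lt_card_light_le hn hl (hF v)).trans ?_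
    rw [Finset.sum_const, nsmul_eq_mul, Finset.card_univ, Fintype.card_fin]
    refine le_of_eq ?_
    calc (n : ℝ) * Real.exp (-(4 * Real.log n))
        = Real.exp (Real.log n + -(4 * Real.log n)) := by rw [Real.exp_add, Real.exp_log hn0]
      _ = _ := by ring_nf
  have hout := hdeg (fun v => Finset.univ.filter fun e => e.1.1 = v) fun v => by
    refine (Finset.card_le_card_of_injOn (fun e => e.1.2) (t := Finset.univ)
      (fun _ _ => Finset.mem_coe.2 (Finset.mem_univ _)) ?_).trans (by simp)
    intro e he e' he' h
    simp only [Finset.coe_filter, Set.mem_ofPred_eq] at he he'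
    exact Subtype.ext (Prod.ext (he.2.trans he'.2.symm) h)
  have hin := hdeg (fun v => Finset.univ.filter fun e => e.1.2 = v) fun v => by
    refine (Finset.card_le_card_of_injOn (fun e => e.1.1) (t := Finset.univ)
      (fun _ _ => Finset.mem_coe.2 (Finset.mem_univ _)) ?_).trans (by simp)
    intro e he e' he' h
    simp only [Finset.coe_filter, Set.mem_ofPred_eq] at he he'
    exact Subtype.ext (Prod.ext h (he.2.trans he'.2.symm))
  simp only [Finset.filter_filter] at hout hin
  have hdist := weightLaw_real_exists_far_le hn h1l (by linarith)
  have hlong := weightLaw_real_exists_long_le hn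
  refine (measureReal_mono (s₂ := (({w | _} ∪ {w | _}) ∪ {w | _}) ∪ {w | _}) ?_
    (measure_ne_top _ _)).trans
    ((measureReal_union_le _ _).trans ((add_le_add ((measureReal_union_le _ _).trans
      (add_le_add ((measureReal_union_le _ _).trans (add_le_add hdist hout)) hin)) hlong).trans ?_))
  · intro w hw
    by_contra hcon
    simp only [Set.mem_union, Set.mem_ofPred_eq, not_or, not_not] at hcon
    exact hw ⟨hcon.1.1.1, hcon.1.1.2, hcon.1.2, hcon.2⟩
  · linarith

end Typical

/-! ### Measurability, and exchanging the two weights of the updated edge -/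

section Update

variable {n : ℕ}

theorem measurable_ncard {Ω : Type*} [MeasurableSpace Ω] {A : Ω → Set (List (Fin n))}
    (hA : ∀ ω, ∀ p ∈ A ω, IsPath p) (hm : ∀ p, MeasurableSet {ω | p ∈ A ω}) :
    Measurable fun ω => ((A ω).ncard : ℝ) := by
  classical
  have h : (fun ω => ((A ω).ncard : ℝ)) = fun ω => ∑ p ∈ (finite_isPath (n := n)).toFinset,
      {ω | p ∈ A ω}.indicator (fun _ => (1 : ℝ)) ω := by
    ext ω
    have hfin : (A ω).Finite := finite_isPath.subset (hA ω)
    rw [Set.ncard_eq_toFinset_card _ hfin, Finset.card_eq_sum_ones, Nat.cast_sum]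
    simp only [Set.indicator_apply, Set.mem_ofPred_eq, Nat.cast_one]
    rw [← Finset.sum_filter]
    refine Finset.sum_congr ?_ fun _ _ => rfl
    ext p
    simp only [Set.Finite.mem_toFinset, Finset.mem_filter, Set.mem_ofPred_eq]
    exact ⟨fun hp => ⟨hA ω p hp, hp⟩, fun hp => hp.2⟩
  rw [h]
  exact Finset.measurable_sum _ fun p _ => measurable_const.indicator (hm p)

theorem integrable_ncard {Ω : Type*} [MeasurableSpace Ω] (ν : Measure Ω) [IsFiniteMeasure ν]
    {A : Ω → Set (List (Fin n))} (hA : ∀ ω, ∀ p ∈ A ω, IsPath p)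
    (hm : ∀ p, MeasurableSet {ω | p ∈ A ω}) : Integrable (fun ω => ((A ω).ncard : ℝ)) ν := by
  refine Integrable.of_bound (C := ({p : List (Fin n) | IsPath p}.ncard : ℝ))
    (measurable_ncard hA hm).aestronglyMeasurable (ae_of_all _ fun ω => ?_)
  rw [Real.norm_of_nonneg (Nat.cast_nonneg _)]
  exact_mod_cast Set.ncard_le_ncard (hA ω) finite_isPath

theorem measurableSet_isShortestPath (p : List (Fin n)) :
    MeasurableSet {w : Edge n → ℝ | IsShortestPath w p} := by
  unfold IsShortestPath
  simp only [Set.ofPred_and, Set.ofPred_forall]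
  refine (MeasurableSet.const _).inter (MeasurableSet.iInter fun q => MeasurableSet.iInter fun _ =>
    MeasurableSet.iInter fun _ => MeasurableSet.iInter fun _ => ?_)
  exact measurableSet_le (measurable_pathCost p) (measurable_pathCost q)

theorem measurableSet_mem_LSP (p : List (Fin n)) :
    MeasurableSet {w : Edge n → ℝ | p ∈ LSP w} :=
  (MeasurableSet.const _).inter
    ((measurableSet_isShortestPath p.tail).inter (measurableSet_isShortestPath p.dropLast))

theorem measurable_edge : Measurable (EdgeUpdate.edge : EdgeUpdate n → Edge n) := measurable_fst

theorem measurable_before : Measurable (EdgeUpdate.before : EdgeUpdate n → Edge n → ℝ) :=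
  measurable_fst.comp measurable_snd

theorem measurable_after : Measurable (EdgeUpdate.after : EdgeUpdate n → Edge n → ℝ) := by
  refine measurable_pi_lambda _ fun e => ?_
  have h : (fun u : EdgeUpdate n => EdgeUpdate.after u e) =
      fun u => if e = u.1 then u.2.2 else u.2.1 e := by
    ext u
    simp [EdgeUpdate.after, Function.update_apply]
  rw [h]
  refine Measurable.ite ?_ measurable_snd.snd ((measurable_pi_apply e).comp measurable_before)
  have h1 : {u : EdgeUpdate n | e = u.1} = EdgeUpdate.edge ⁻¹' {e} := by
    ext u
    exact eq_comm
  rw [h1]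
  exact measurable_edge (measurableSet_singleton e)

theorem measurableSet_passesThrough_edge (p : List (Fin n)) :
    MeasurableSet {u : EdgeUpdate n | PassesThrough p (EdgeUpdate.edge u)} :=
  measurable_edge (Set.toFinite {e | PassesThrough p e}).measurableSet

theorem measurableSet_mem_destroyedLSP (p : List (Fin n)) :
    MeasurableSet {u : EdgeUpdate n | p ∈ destroyedLSP u} :=
  ((measurable_before (measurableSet_mem_LSP p)).inter
    (measurableSet_passesThrough_edge p)).union
    ((measurable_before (measurableSet_mem_LSP p)).diff
      (measurable_after (measurableSet_mem_LSP p)))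

theorem isPath_of_mem_destroyedLSP (u : EdgeUpdate n) : ∀ p ∈ destroyedLSP u, IsPath p := by
  rintro p (hp | hp)
  · exact hp.1.1
  · exact hp.1.1

/-- The reversed update, which gives the updated edge its old weight back. -/
noncomputable def EdgeUpdate.reverse (u : EdgeUpdate n) : EdgeUpdate n :=
  (u.1, EdgeUpdate.after u, u.2.1 u.1)

theorem EdgeUpdate.after_reverse (u : EdgeUpdate n) :
    EdgeUpdate.after (EdgeUpdate.reverse u) = EdgeUpdate.before u := by
  simp [EdgeUpdate.after, EdgeUpdate.reverse, EdgeUpdate.before]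

theorem destroyedLSP_reverse (u : EdgeUpdate n) :
    destroyedLSP (EdgeUpdate.reverse u) = createdLSP u := by
  unfold destroyedLSP createdLSP
  rw [EdgeUpdate.after_reverse]
  rfl

theorem measurable_reverse : Measurable (EdgeUpdate.reverse : EdgeUpdate n → EdgeUpdate n) := by
  refine measurable_fst.prodMk (measurable_after.prodMk ?_)
  exact measurable_from_prod_countable_right fun e => (measurable_pi_apply e).comp measurable_fst

/-- Exchanging the weight of `e` with an independent uniform weight preserves the law of both. -/
theorem map_exchange_weight (e : Edge n) :
    ((weightLaw n).prod uniform01).map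
      (fun z => (Function.update z.1 e z.2, z.1 e)) = (weightLaw n).prod uniform01 := by
  have hmeas : Measurable fun z : (Edge n → ℝ) × ℝ => (Function.update z.1 e z.2, z.1 e) :=
    measurable_snd.comp (measurable_reverse.comp (measurable_const (a := e) |>.prodMk measurable_id))
  symm
  refine Measure.prod_eq_generateFrom generateFrom_pi
    MeasurableSpace.generateFrom_measurableSet isPiSystem_pi
    MeasurableSpace.isPiSystem_measurableSet
    ⟨fun _ => Set.univ, fun _ => ⟨fun _ => Set.univ, fun _ _ => MeasurableSet.univ, Set.pi_univ _⟩,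
      fun _ => measure_lt_top _ _, Set.iUnion_const _⟩
    (Measure.toFiniteSpanningSetsIn _) ?_
  rintro _ ⟨s, hs, rfl⟩ t ht
  have hs' : ∀ e', MeasurableSet (s e') := fun e' => hs e' trivial
  have ht' : MeasurableSet t := ht
  rw [Measure.map_apply hmeas ((MeasurableSet.univ_pi hs').prod ht')]
  have hpre : (fun z : (Edge n → ℝ) × ℝ => (Function.update z.1 e z.2, z.1 e)) ⁻¹'
      (Set.univ.pi s ×ˢ t) = (Set.univ.pi (Function.update s e t)) ×ˢ (s e) := by
    ext ⟨w, x⟩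
    simp only [Set.mem_preimage, Set.mem_prod, Set.mem_pi, Set.mem_univ, true_implies]
    constructor
    · rintro ⟨h1, h2⟩
      refine ⟨fun e' => ?_, by simpa using h1 e⟩
      by_cases he : e' = e
      · subst he; simpa using h2
      · simpa [he] using h1 e'
    · rintro ⟨h1, h2⟩
      refine ⟨fun e' => ?_, by simpa using h1 e⟩
      by_cases he : e' = e
      · subst he; simpa using h2
      · simpa [he] using h1 e'
  rw [hpre, Measure.prod_prod, Measure.pi_pi, Measure.pi_pi,
    ← Finset.mul_prod_erase Finset.univ _ (Finset.mem_univ e),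
    ← Finset.mul_prod_erase Finset.univ (fun e' => uniform01 (s e')) (Finset.mem_univ e)]
  have : ∏ e' ∈ Finset.univ.erase e, uniform01 (Function.update s e t e') =
      ∏ e' ∈ Finset.univ.erase e, uniform01 (s e') :=
    Finset.prod_congr rfl fun e' he' => by rw [Function.update_of_ne (Finset.ne_of_mem_erase he')]
  rw [this, Function.update_self]
  ring

theorem nonempty_edge (hn : 2 ≤ n) : Nonempty (Edge n) :=
  ⟨⟨(⟨0, by omega⟩, ⟨1, by omega⟩), by simp⟩⟩

theorem isProbabilityMeasure_randomEdgeUpdate (hn : 2 ≤ n) :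
    IsProbabilityMeasure (randomEdgeUpdate n) := by
  have := nonempty_edge hn
  unfold randomEdgeUpdate
  infer_instance

/-- The random edge update is reversible. -/
theorem measurePreserving_reverse (hn : 2 ≤ n) :
    MeasurePreserving EdgeUpdate.reverse (randomEdgeUpdate n) (randomEdgeUpdate n) := by
  have := nonempty_edge hn
  exact (MeasurePreserving.id _).skew_product
    (g := fun (e : Edge n) (z : (Edge n → ℝ) × ℝ) => (Function.update z.1 e z.2, z.1 e))
    (measurable_snd.comp measurable_reverse) (ae_of_all _ map_exchange_weight)

theorem integral_comp_reverse (hn : 2 ≤ n) {f : EdgeUpdate n → ℝ} (hf : Measurable f) :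
    ∫ u, f (EdgeUpdate.reverse u) ∂randomEdgeUpdate n = ∫ u, f u ∂randomEdgeUpdate n := by
  have h := measurePreserving_reverse hn
  rw [← integral_map h.measurable.aemeasurable hf.aestronglyMeasurable, h.map_eq]

/-- The expectation of a quantity of an edge and the weights before the update is its average over
all edges. -/
theorem integral_randomEdgeUpdate_le (hn : 2 ≤ n) {h : Edge n → (Edge n → ℝ) → ℝ}
    (hint : ∀ e, Integrable (h e) (weightLaw n))
    (hint' : Integrable (fun u => h (EdgeUpdate.edge u) (EdgeUpdate.before u)) (randomEdgeUpdate n))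
    {B : Set (Edge n → ℝ)} (hB : MeasurableSet B) {a b : ℝ}
    (hle : ∀ᵐ w ∂weightLaw n, ∑ e, h e w ≤ a + b * B.indicator 1 w) :
    ∫ u, h (EdgeUpdate.edge u) (EdgeUpdate.before u) ∂randomEdgeUpdate n ≤
      (a + b * (weightLaw n).real B) / Fintype.card (Edge n) := by
  have := nonempty_edge hn
  have hone : ∀ e : Edge n, (ProbabilityTheory.uniformOn (Set.univ : Set (Edge n))).real {e} =
      (Fintype.card (Edge n) : ℝ)⁻¹ := by
    intro e
    rw [Measure.real, ProbabilityTheory.uniformOn_univ, Measure.count_singleton,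
      ENNReal.toReal_div, ENNReal.toReal_one, ENNReal.toReal_natCast, one_div]
  have h1 : ∫ u, h (EdgeUpdate.edge u) (EdgeUpdate.before u) ∂randomEdgeUpdate n =
      (Fintype.card (Edge n) : ℝ)⁻¹ * ∫ w, ∑ e, h e w ∂weightLaw n := by
    unfold randomEdgeUpdate at hint' ⊢
    rw [integral_prod _ hint', integral_fintype Integrable.of_finite,
      integral_finsetSum _ fun e _ => hint e, Finset.mul_sum]
    refine Finset.sum_congr rfl fun e _ => ?_
    rw [hone, smul_eq_mul]
    congr 1
    exact (integral_fun_fst (μ := weightLaw n) (ν := uniform01) (h e)).trans (by simp)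
  have hBint : Integrable (B.indicator (1 : (Edge n → ℝ) → ℝ)) (weightLaw n) :=
    (integrable_const (1 : ℝ)).indicator hB
  have h2 : ∫ w, ∑ e, h e w ∂weightLaw n ≤ a + b * (weightLaw n).real B := by
    calc ∫ w, ∑ e, h e w ∂weightLaw n
        ≤ ∫ w, (a + b * B.indicator (1 : (Edge n → ℝ) → ℝ) w) ∂weightLaw n :=
          integral_mono_ae (integrable_finsetSum _ fun e _ => hint e)
            ((integrable_const _).add (hBint.const_mul b)) hle
      _ = a + b * (weightLaw n).real B := by
          rw [integral_add (integrable_const _) (hBint.const_mul b), integral_const_mul,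
            integral_indicator_one hB]
          simp
  rw [h1, div_eq_inv_mul]
  gcongr

end Update

/-! ### The expected number of destroyed paths -/

section Expectation

variable {n : ℕ}

theorem measurableSet_mem_through {A : (Edge n → ℝ) → Set (List (Fin n))}
    (hA : ∀ p, MeasurableSet {w | p ∈ A w}) (p : List (Fin n)) :
    MeasurableSet {u : EdgeUpdate n | p ∈ A (EdgeUpdate.before u) ∧
      PassesThrough p (EdgeUpdate.edge u)} :=
  (measurable_before (hA p)).inter (measurableSet_passesThrough_edge p)

theorem integrable_ncard_destroyedLSP (hn : 2 ≤ n) :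
    Integrable (fun u : EdgeUpdate n => ((destroyedLSP u).ncard : ℝ)) (randomEdgeUpdate n) := by
  have := isProbabilityMeasure_randomEdgeUpdate hn
  exact integrable_ncard _ isPath_of_mem_destroyedLSP measurableSet_mem_destroyedLSP

theorem integrable_ncard_createdLSP (hn : 2 ≤ n) :
    Integrable (fun u : EdgeUpdate n => ((createdLSP u).ncard : ℝ)) (randomEdgeUpdate n) := by
  simp_rw [← destroyedLSP_reverse]
  exact (measurePreserving_reverse hn).integrable_comp_of_integrable
    (integrable_ncard_destroyedLSP hn)

theorem expectedDestroyedLSP_eq_expectedCreatedLSP (hn : 2 ≤ n) :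
    expectedDestroyedLSP n = expectedCreatedLSP n := by
  unfold expectedDestroyedLSP expectedCreatedLSP
  simp_rw [← destroyedLSP_reverse]
  exact (integral_comp_reverse hn
    (measurable_ncard isPath_of_mem_destroyedLSP measurableSet_mem_destroyedLSP)).symm

theorem sq_le_two_mul_card_edge (hn : 2 ≤ n) : (n : ℝ) ^ 2 ≤ 2 * Fintype.card (Edge n) := by
  have h1 : Fintype.card (Edge n) = n * n - n := by
    rw [Fintype.card_subtype]
    have : (Finset.univ.filter fun p : Fin n × Fin n => p.1 ≠ p.2) =
        (Finset.univ : Finset (Fin n)).offDiag := by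
      ext p; simp
    rw [this, Finset.offDiag_card, Finset.card_univ, Fintype.card_fin]
  have h2 : n ≤ n * n := Nat.le_mul_self n
  rw [h1, Nat.cast_sub h2]
  have : (2 : ℝ) ≤ n := by exact_mod_cast hn
  push_cast
  nlinarith

/-- If the sets `A w` of paths are not larger than `c` and their paths have at most `M` edges
outside an event `B`, and `A w` has at most `n ^ 3` elements in any case, then few paths of `A`
pass through a random edge. -/
theorem integral_ncard_through_le (hn : 2 ≤ n) {A : (Edge n → ℝ) → Set (List (Fin n))}
    (hA : ∀ w, ∀ p ∈ A w, IsPath p) (hm : ∀ p, MeasurableSet {w | p ∈ A w})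
    {B : Set (Edge n → ℝ)} (hB : MeasurableSet B) {c M : ℕ}
    (hgood : ∀ᵐ w ∂weightLaw n, w ∉ B → (A w).ncard ≤ c ∧ ∀ p ∈ A w, p.length ≤ M + 1)
    (hbad : ∀ᵐ w ∂weightLaw n, (A w).ncard ≤ n ^ 3) :
    ∫ u, ({p | p ∈ A (EdgeUpdate.before u) ∧ PassesThrough p (EdgeUpdate.edge u)}.ncard : ℝ)
      ∂randomEdgeUpdate n ≤ (c * M + n ^ 4 * (weightLaw n).real B) / Fintype.card (Edge n) := by
  have := isProbabilityMeasure_randomEdgeUpdate hn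
  refine integral_randomEdgeUpdate_le hn
    (h := fun e w => ({p | p ∈ A w ∧ PassesThrough p e}.ncard : ℝ)) (fun e => ?_) ?_ hB ?_
  · exact integrable_ncard _ (fun w p hp => hA w p hp.1)
      fun p => (hm p).inter (MeasurableSet.const (PassesThrough p e))
  · exact integrable_ncard _ (fun u p hp => hA _ p hp.1) (measurableSet_mem_through hm)
  · filter_upwards [hgood, hbad] with w h1 h2
    by_cases hw : w ∈ B
    · have h3 := sum_ncard_passesThrough_le (hA w) (M := n)
        fun p hp => (hA w p hp).length_le.trans (Nat.le_succ n)
      have h4 : ∑ e : Edge n, {p | p ∈ A w ∧ PassesThrough p e}.ncard ≤ n ^ 4 :=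
        h3.trans ((Nat.mul_le_mul_right n h2).trans_eq (by ring))
      have h5 : (∑ e : Edge n, ({p | p ∈ A w ∧ PassesThrough p e}.ncard : ℝ)) ≤ (n : ℝ) ^ 4 := by
        exact_mod_cast h4
      have h6 : (0 : ℝ) ≤ c * M := by positivity
      simpa [hw] using by linarith
    · obtain ⟨h3, h4⟩ := h1 hw
      have h5 := (sum_ncard_passesThrough_le (hA w) h4).trans (Nat.mul_le_mul_right M h3)
      have h6 : (∑ e : Edge n, ({p | p ∈ A w ∧ PassesThrough p e}.ncard : ℝ)) ≤ c * M := by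
        exact_mod_cast h5
      simpa [hw] using h6

theorem ae_randomEdgeUpdate_of_before (hn : 2 ≤ n) {P : (Edge n → ℝ) → Prop}
    (h : ∀ᵐ w ∂weightLaw n, P w) : ∀ᵐ u ∂randomEdgeUpdate n, P (EdgeUpdate.before u) := by
  have := nonempty_edge hn
  exact Measure.quasiMeasurePreserving_snd.ae (Measure.quasiMeasurePreserving_fst.ae h)

theorem ae_randomEdgeUpdate_newWeight_nonneg (hn : 2 ≤ n) :
    ∀ᵐ u ∂randomEdgeUpdate n, 0 ≤ u.2.2 := by
  have := nonempty_edge hn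
  have h : ∀ᵐ x ∂uniform01, (0 : ℝ) ≤ x := ae_uniform01_mem.mono fun x hx => hx.1
  exact Measure.quasiMeasurePreserving_snd.ae
    (Measure.quasiMeasurePreserving_snd.ae (p := fun x : ℝ => 0 ≤ x) h)

/-- The bound on the expected number of destroyed paths in terms of the parameters of typical
weights. -/
theorem expectedDestroyedLSP_le (hn : 2 ≤ n) {r ε : ℝ} {D m : ℕ}
    (hε : (weightLaw n).real {w | ¬ IsTypical w r D m} ≤ ε) :
    expectedDestroyedLSP n ≤
      (((n ^ 2 + n ^ 2 * D : ℕ) : ℝ) * m + n ^ 4 * ε) / Fintype.card (Edge n) +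
      (((n ^ 2 : ℕ) : ℝ) * m + n ^ 4 * ε) / Fintype.card (Edge n) * (2 * D) + n ^ 3 * ε := by
  have hprob := isProbabilityMeasure_randomEdgeUpdate hn
  -- A measurable event of the same probability that contains all atypical weights.
  set B := toMeasurable (weightLaw n) {w | ¬ IsTypical w r D m} with hBdef
  have hB : MeasurableSet B := measurableSet_toMeasurable _ _
  have hBε : (weightLaw n).real B ≤ ε := by
    rwa [hBdef, Measure.real, measure_toMeasurable]
  have htyp : ∀ w, w ∉ B → IsTypical w r D m := fun w hw => by
    by_contra h
    exact hw (subset_toMeasurable _ _ h)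
  have hnonneg : ∀ᵐ w ∂weightLaw n, ∀ e, 0 ≤ w e :=
    ae_weightLaw_mem.mono fun w hw e => (hw e).1
  have hL := integral_ncard_through_le hn (A := LSP) (fun w p hp => hp.1) measurableSet_mem_LSP hB
    (c := n ^ 2 + n ^ 2 * D) (M := m)
    (by
      filter_upwards [hnonneg, ae_hasUniqueCosts] with w h0 hu hw
      exact ⟨(htyp w hw).ncard_LSP_le h0 hu, fun p hp => (htyp w hw).length_LSP_le h0 hp⟩)
    (ae_hasUniqueCosts.mono fun w hu => ncard_LSP_le hu)
  have hS := integral_ncard_through_le hn (A := SP) (fun w p hp => hp.1)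
    measurableSet_isShortestPath hB (c := n ^ 2) (M := m)
    (by
      filter_upwards [hnonneg, ae_hasUniqueCosts] with w h0 hu hw
      exact ⟨ncard_SP_le hu, fun p hp => ((htyp w hw).length_le h0 hp).trans (Nat.le_succ m)⟩)
    (ae_hasUniqueCosts.mono fun w hu =>
      (ncard_SP_le hu).trans (Nat.pow_le_pow_right (by omega) (by norm_num)))
  have hpt : ∀ᵐ u ∂randomEdgeUpdate n, ((destroyedLSP u).ncard : ℝ) ≤
      ((LSPThrough (EdgeUpdate.before u) (EdgeUpdate.edge u)).ncard : ℝ) +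
      ((SPThrough (EdgeUpdate.after u) (EdgeUpdate.edge u)).ncard : ℝ) * (2 * D) +
      n ^ 3 * B.indicator 1 (EdgeUpdate.before u) := by
    filter_upwards [ae_randomEdgeUpdate_of_before hn hnonneg,
      ae_randomEdgeUpdate_of_before hn ae_hasUniqueCosts,
      ae_randomEdgeUpdate_newWeight_nonneg hn] with u h0 hu hx
    -- For atypical weights, all locally shortest paths are counted.
    by_cases hw : EdgeUpdate.before u ∈ B
    · have h1 : (destroyedLSP u).ncard ≤ n ^ 3 := by
        refine (Set.ncard_le_ncard ?_ (finite_LSP _)).trans (ncard_LSP_le hu)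
        rintro p (hp | hp)
        · exact hp.1
        · exact hp.1
      have h2 : ((destroyedLSP u).ncard : ℝ) ≤ (n : ℝ) ^ 3 := by exact_mod_cast h1
      rw [Set.indicator_of_mem hw, Pi.one_apply, mul_one]
      have h3 : (0 : ℝ) ≤ ((LSPThrough (EdgeUpdate.before u) (EdgeUpdate.edge u)).ncard : ℝ) +
        ((SPThrough (EdgeUpdate.after u) (EdgeUpdate.edge u)).ncard : ℝ) * (2 * D) := by
        positivity
      linarith
    · have h1 : (destroyedLSP u).ncard ≤ _ :=
        (htyp _ hw).ncard_destroyed_le h0 hu (EdgeUpdate.edge u) hx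
      rw [Set.indicator_of_notMem hw, mul_zero, add_zero]
      exact_mod_cast h1
  have hSm : Measurable fun u : EdgeUpdate n =>
      ((SPThrough (EdgeUpdate.before u) (EdgeUpdate.edge u)).ncard : ℝ) :=
    measurable_ncard (fun u p hp => hp.1.1) (measurableSet_mem_through measurableSet_isShortestPath)
  have hSi : Integrable (fun u : EdgeUpdate n =>
      ((SPThrough (EdgeUpdate.before u) (EdgeUpdate.edge u)).ncard : ℝ)) (randomEdgeUpdate n) :=
    integrable_ncard _ (fun u p hp => hp.1.1)
      (measurableSet_mem_through measurableSet_isShortestPath)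
  have hLi : Integrable (fun u : EdgeUpdate n =>
      ((LSPThrough (EdgeUpdate.before u) (EdgeUpdate.edge u)).ncard : ℝ)) (randomEdgeUpdate n) :=
    integrable_ncard _ (fun u p hp => hp.1.1) (measurableSet_mem_through measurableSet_mem_LSP)
  -- The weights after the update are distributed like those before it.
  have hSrev : ∫ u, ((SPThrough (EdgeUpdate.after u) (EdgeUpdate.edge u)).ncard : ℝ)
      ∂randomEdgeUpdate n = ∫ u, ((SPThrough (EdgeUpdate.before u) (EdgeUpdate.edge u)).ncard : ℝ)
      ∂randomEdgeUpdate n := integral_comp_reverse hn hSm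
  have hSi' : Integrable (fun u : EdgeUpdate n =>
      ((SPThrough (EdgeUpdate.after u) (EdgeUpdate.edge u)).ncard : ℝ)) (randomEdgeUpdate n) :=
    (measurePreserving_reverse hn).integrable_comp_of_integrable hSi
  have hBi : Integrable (fun u : EdgeUpdate n =>
      B.indicator (1 : (Edge n → ℝ) → ℝ) (EdgeUpdate.before u)) (randomEdgeUpdate n) :=
    (integrable_const (1 : ℝ)).indicator (measurable_before hB)
  have hBint : ∫ u, B.indicator (1 : (Edge n → ℝ) → ℝ) (EdgeUpdate.before u) ∂randomEdgeUpdate n =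
      (weightLaw n).real B := by
    have h1 : (fun u : EdgeUpdate n => B.indicator (1 : (Edge n → ℝ) → ℝ) (EdgeUpdate.before u)) =
        (EdgeUpdate.before ⁻¹' B).indicator 1 := rfl
    have := nonempty_edge hn
    have h2 : (randomEdgeUpdate n) (EdgeUpdate.before ⁻¹' B) = weightLaw n B := by
      have h3 : (EdgeUpdate.before ⁻¹' B : Set (EdgeUpdate n)) =
          Set.univ ×ˢ (B ×ˢ Set.univ) := by
        ext u; simp [EdgeUpdate.before]
      rw [h3, randomEdgeUpdate, Measure.prod_prod, Measure.prod_prod]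
      simp
    rw [h1, integral_indicator_one (measurable_before hB), Measure.real, h2, Measure.real]
  calc expectedDestroyedLSP n
      ≤ ∫ u, (((LSPThrough (EdgeUpdate.before u) (EdgeUpdate.edge u)).ncard : ℝ) +
        ((SPThrough (EdgeUpdate.after u) (EdgeUpdate.edge u)).ncard : ℝ) * (2 * D) +
        n ^ 3 * B.indicator (1 : (Edge n → ℝ) → ℝ) (EdgeUpdate.before u)) ∂randomEdgeUpdate n :=
        integral_mono_ae (integrable_ncard_destroyedLSP hn)
          ((hLi.add (hSi'.mul_const _)).add (hBi.const_mul _)) hpt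
    _ = (∫ u, ((LSPThrough (EdgeUpdate.before u) (EdgeUpdate.edge u)).ncard : ℝ)
          ∂randomEdgeUpdate n) +
        (∫ u, ((SPThrough (EdgeUpdate.before u) (EdgeUpdate.edge u)).ncard : ℝ)
          ∂randomEdgeUpdate n) * (2 * D) + n ^ 3 * (weightLaw n).real B := by
        have hLSi : Integrable (fun u : EdgeUpdate n =>
            ((LSPThrough (EdgeUpdate.before u) (EdgeUpdate.edge u)).ncard : ℝ) +
            ((SPThrough (EdgeUpdate.after u) (EdgeUpdate.edge u)).ncard : ℝ) * (2 * D))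
            (randomEdgeUpdate n) := hLi.add (hSi'.mul_const _)
        rw [integral_add hLSi (hBi.const_mul _), integral_add hLi (hSi'.mul_const _),
          integral_mul_const, integral_const_mul, hBint, hSrev]
    _ ≤ _ := by
        refine add_le_add (add_le_add (hL.trans ?_)
          (mul_le_mul_of_nonneg_right (hS.trans ?_) (by positivity))) ?_ <;> gcongr

theorem expectedDestroyedLSP_le_log_sq (hn : 24 ≤ n) (h1l : 1 ≤ Real.log n)
    (hl : 256 * Real.log n ≤ n) : expectedDestroyedLSP n ≤ 3000000 * Real.log n ^ 2 := by
  have hn0 : (0 : ℝ) < n := by exact_mod_cast (by omega : 0 < n)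
  have hn1 : (1 : ℝ) ≤ n := by exact_mod_cast (by omega : 1 ≤ n)
  have h := expectedDestroyedLSP_le (by omega) (weightLaw_real_not_isTypical_le hn h1l hl)
  have hD := (Nat.ceil_lt_add_one (show 0 ≤ 516 * Real.log n by positivity)).le
  have hm := (Nat.ceil_lt_add_one (show 0 ≤ 773 * Real.log n by positivity)).le
  set D := ⌈516 * Real.log n⌉₊
  set m := ⌈773 * Real.log n⌉₊
  have hε : (n : ℝ) ^ 3 * (4 * Real.exp (-(3 * Real.log n))) = 4 := by
    have : Real.exp (-(3 * Real.log n)) = ((n : ℝ) ^ 3)⁻¹ := by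
      rw [Real.exp_neg, mul_comm, Real.exp_mul, Real.exp_log hn0]
      norm_cast
    rw [this]
    field_simp
  have hε4 : (n : ℝ) ^ 4 * (4 * Real.exp (-(3 * Real.log n))) ≤ 4 * (n : ℝ) ^ 2 := by
    calc (n : ℝ) ^ 4 * (4 * Real.exp (-(3 * Real.log n)))
        = (n : ℝ) * ((n : ℝ) ^ 3 * (4 * Real.exp (-(3 * Real.log n)))) := by ring
      _ = 4 * (n : ℝ) := by rw [hε]; ring
      _ ≤ 4 * (n : ℝ) ^ 2 := by nlinarith
  rw [hε] at h
  have hN := sq_le_two_mul_card_edge (n := n) (by omega)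
  have hNpos : (0 : ℝ) < Fintype.card (Edge n) := by nlinarith
  have hdiv : ∀ x : ℝ, 0 ≤ x → x * (n : ℝ) ^ 2 / Fintype.card (Edge n) ≤ 2 * x := by
    intro x hx
    rw [div_le_iff₀ hNpos]
    nlinarith
  have h1 : (((n ^ 2 + n ^ 2 * D : ℕ) : ℝ) * m + n ^ 4 * (4 * Real.exp (-(3 * Real.log n)))) /
      Fintype.card (Edge n) ≤ 2 * ((1 + D) * m + 4) := by
    refine le_trans ?_ (hdiv ((1 + D) * m + 4) (by positivity))
    gcongr
    push_cast
    linarith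
  have h2 : (((n ^ 2 : ℕ) : ℝ) * m + n ^ 4 * (4 * Real.exp (-(3 * Real.log n)))) /
      Fintype.card (Edge n) ≤ 2 * (m + 4) := by
    refine le_trans ?_ (hdiv (m + 4) (by positivity))
    gcongr
    push_cast
    linarith
  have h3 := mul_le_mul_of_nonneg_right h2 (show (0 : ℝ) ≤ 2 * D by positivity)
  have hD' : (D : ℝ) ≤ 517 * Real.log n := by linarith
  have hm' : (m : ℝ) ≤ 774 * Real.log n := by linarith
  have hDm : (D : ℝ) * m ≤ 517 * Real.log n * (774 * Real.log n) :=
    mul_le_mul hD' hm' (by positivity) (by positivity)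
  have hl2 : Real.log n ≤ Real.log n ^ 2 := by nlinarith
  nlinarith

end Expectation

end RandomAPSP

theorem mainTheorem6 :
    (∀ n : ℕ, 2 ≤ n →
      Integrable (fun u : RandomAPSP.EdgeUpdate n => ((RandomAPSP.destroyedLSP u).ncard : ℝ))
        (RandomAPSP.randomEdgeUpdate n) ∧
      Integrable (fun u : RandomAPSP.EdgeUpdate n => ((RandomAPSP.createdLSP u).ncard : ℝ))
        (RandomAPSP.randomEdgeUpdate n) ∧
      RandomAPSP.expectedDestroyedLSP n = RandomAPSP.expectedCreatedLSP n) ∧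
    (fun n : ℕ => RandomAPSP.expectedDestroyedLSP n) =O[atTop]
      (fun n : ℕ => Real.log (n : ℝ) ^ 2) ∧
    (fun n : ℕ => RandomAPSP.expectedCreatedLSP n) =O[atTop]
      (fun n : ℕ => Real.log (n : ℝ) ^ 2) := by
  have hO : (fun n : ℕ => RandomAPSP.expectedDestroyedLSP n) =O[atTop]
      (fun n : ℕ => Real.log (n : ℝ) ^ 2) := by
    have hlog : ∀ᶠ n : ℕ in atTop, 1 ≤ Real.log (n : ℝ) :=
      (Real.tendsto_log_atTop.comp tendsto_natCast_atTop_atTop).eventually_ge_atTop 1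
    have hlin : ∀ᶠ n : ℕ in atTop, 256 * Real.log (n : ℝ) ≤ n := by
      have h := (Real.isLittleO_log_id_atTop.comp_tendsto
        (tendsto_natCast_atTop_atTop (R := ℝ))).bound (show (0 : ℝ) < 1 / 256 by norm_num)
      filter_upwards [h] with n hn
      simp only [Function.comp_apply, id_eq, Real.norm_eq_abs, Nat.abs_cast] at hn
      linarith [le_abs_self (Real.log (n : ℝ))]
    refine IsBigO.of_bound 3000000 ?_
    filter_upwards [hlog, hlin, eventually_ge_atTop 24] with n h1 h2 h3
    have h0 : 0 ≤ RandomAPSP.expectedDestroyedLSP n := integral_nonneg fun u => Nat.cast_nonneg _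
    rw [Real.norm_of_nonneg h0, Real.norm_of_nonneg (sq_nonneg _)]
    exact RandomAPSP.expectedDestroyedLSP_le_log_sq h3 h1 h2
  refine ⟨fun n hn => ⟨RandomAPSP.integrable_ncard_destroyedLSP hn,
    RandomAPSP.integrable_ncard_createdLSP hn,
    RandomAPSP.expectedDestroyedLSP_eq_expectedCreatedLSP hn⟩, hO, hO.congr' ?_ EventuallyEq.rfl⟩
  filter_upwards [eventually_ge_atTop 2] with n hn
  exact RandomAPSP.expectedDestroyedLSP_eq_expectedCreatedLSP hn
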